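/- For integers $m\ge 3$ and $k\ge 0$ let $F(m,k)$ be the $m$-barrel fullerene graph with $k$ layers of hexagons, drawn on a cylinder: its $m(k+2)$ horizontal edges $e_{j,l}$, $0\le j\le k+1$, $l\in I_m=\{0,\dots,m-1\}$ (with $l$ read modulo $m$) cover every vertex exactly once; for $0\le j\le k$ the right endpoints of the edges $e_{j,l}$ and the left endpoints of the edges $e_{j+1,l}$ form a cycle of length $2m$, in which the left endpoint of $e_{j+1,l}$ is adjacent to the right endpoints of $e_{j,l}$ and $e_{j,l+1}$; the left endpoints of $e_{0,0},\dots,e_{0,m-1}$, and likewise the right endpoints of $e_{k+1,0},\dots,e_{k+1,m-1}$, form an $m$-gon in this cyclic order. The edges $e_{j,0},\dots,e_{j,m-1}$ form the slice $E_j$. Let $\Phi(G)$ be the number of perfect matchings of a graph $G$. Let $A=(a_{S,T})_{S,T\subset I_m}$ be the transfer matrix: $a_{S,T}$ is the number of perfect matchings of the cycle of length $2m$ between two consecutive slices after removal of the vertices attached to the edges with index in $S$ of the left slice and with index in $T$ of the right slice. The sector $p$ ($0\le p\le m$) is the block of $A$ indexed by the subsets with $p$ elements. The largest eigenvalue of a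 real square matrix is understood in the Perron--Frobenius sense: a real eigenvalue that is at least the modulus of every complex eigenvalue. **Theorem.** Fix $m\ge 3$ and let $p_0=m-2\lfloor\frac{m+1}{3}\rfloor$. 1. For every $0\le p\le m$, the largest eigenvalue of $A$ in the sector $p$ is $$\lambda_{\max}^{(p)}=\begin{cases}\dfrac{2}{\prod_{r=0}^{q-1}4\sin^2\left(\pi\frac{2r+1}{2m}\right)} & \text{if } p=2q,\\[3ex] \dfrac{m}{\prod_{r=1}^{q}4\sin^2\left(\frac{\pi r}{m}\right)} & \text{if } p=2q+1.\end{cases}$$ 2. The growth constant $\rho(m)=\lim_{k\to\infty}\Phi(F(m,k))^{1/k}$ exists and $\rho(m)=\lambda_{\max}^{(p_0)}$. 3. For a uniformly random perfect matching of $F(m,k)$, the number of horizontal edges in every slice converges in probability to $p_0$ as $k\to\infty$, uniformly in the slice: for every $\varepsilon>0$, the probability that some slice $E_j$, $0\le j\le k+1$, contains a number $N_j$ of matching edges with $|N_j-p_0|\ge\varepsilon$ tends to $0$. 4. The contribution of the other sectors is exponentially smaller: there are constants $C>0$ and $r\in(0,1)$, depending only on $m$, such that for every $k\ge0$ the number of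 perfect matchings of $F(m,k)$ that have a slice containing a number of matching edges different from $p_0$ is at most $C\,r^k\,(\lambda_{\max}^{(p_0)})^k$. -/

import Mathlib

open Filter Topology

/-- Vertices of the `m`-barrel fullerene `F(m,k)`, drawn on a cylinder whose axis is horizontal.
Every vertex is an endpoint of exactly one horizontal edge `e_{j,l}`, where `j = 0, …, k+1`
is the slice and `l` (cyclic, modulo `m`) is the height.
`(j, l, false)` is the left endpoint of `e_{j,l}` and `(j, l, true)` is its right endpoint. -/
abbrev BarrelVertex (m k : ℕ) : Type := Fin (k + 2) × Fin m × Bool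

/-- The edges of `F(m,k)`; `finRotate m l` is `l + 1` modulo `m`.
* `horizontal`: the edge `e_{j,l}`.
* `below`, `above`: the `k + 1` cycles of length `2m`, separating slice `j` from slice `j + 1`.
  The left endpoint of `e_{j+1,l}` lies on that cycle between the right endpoints of `e_{j,l}`
  (just below) and of `e_{j,l+1}` (just above).
* `leftGon`, `rightGon`: the two `m`-gons at the ends of the cylinder. -/
inductive BarrelEdge (m k : ℕ) : BarrelVertex m k → BarrelVertex m k → Prop
  | horizontal (j : Fin (k + 2)) (l : Fin m) : BarrelEdge m k (j, l, false) (j, l, true)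
  | below (j : Fin (k + 1)) (l : Fin m) :
      BarrelEdge m k (j.castSucc, l, true) (j.succ, l, false)
  | above (j : Fin (k + 1)) (l : Fin m) :
      BarrelEdge m k (j.castSucc, finRotate m l, true) (j.succ, l, false)
  | leftGon (l : Fin m) : BarrelEdge m k (0, l, false) (0, finRotate m l, false)
  | rightGon (l : Fin m) :
      BarrelEdge m k (Fin.last (k + 1), l, true) (Fin.last (k + 1), finRotate m l, true)

/-- The `m`-barrel fullerene `F(m,k)` (for `m ≥ 3`), with `k` layers of hexagons. -/
def barrelFullerene (m k : ℕ) : SimpleGraph (BarrelVertex m k) :=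
  SimpleGraph.fromRel (BarrelEdge m k)

/-- The perfect matchings of a graph. -/
abbrev PerfectMatching {V : Type*} (G : SimpleGraph V) : Type _ :=
  {M : G.Subgraph // M.IsPerfectMatching}

/-- `Φ(G)`, the number of perfect matchings of `G`. -/
noncomputable def numPerfectMatchings {V : Type*} (G : SimpleGraph V) : ℕ :=
  Nat.card (PerfectMatching G)

/-- The number of horizontal edges (horizontal rhombi) of a perfect matching in slice `j`. -/
noncomputable def horizontalCount {m k : ℕ} (M : PerfectMatching (barrelFullerene m k))
    (j : Fin (k + 2)) : ℕ :=
  Nat.card {l : Fin m // M.1.Adj (j, l, false) (j, l, true)}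

/-- Probability of an event for a uniformly random perfect matching of `F(m,k)`. -/
noncomputable def matchingProb (m k : ℕ) (E : Set (PerfectMatching (barrelFullerene m k))) : ℝ :=
  (Nat.card E : ℝ) / (numPerfectMatchings (barrelFullerene m k) : ℝ)

/-- The cycle of length `2m` between two consecutive slices: `Sum.inl l` is attached to the
`l`-th horizontal edge on the left and `Sum.inr l` to the `l`-th horizontal edge on the right. -/
def layerCycle (m : ℕ) : SimpleGraph (Fin m ⊕ Fin m) :=
  SimpleGraph.fromRel fun u v =>
    ∃ l : Fin m, v = Sum.inr l ∧ (u = Sum.inl l ∨ u = Sum.inl (finRotate m l))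

/-- The vertices of the cycle that remain after removing those attached to the horizontal edges
in `S` (on the left) and in `T` (on the right). -/
def layerRemaining (m : ℕ) (S T : Finset (Fin m)) : Set (Fin m ⊕ Fin m) :=
  {v | (∀ l ∈ S, v ≠ Sum.inl l) ∧ (∀ l ∈ T, v ≠ Sum.inr l)}

/-- The transfer matrix `A`, indexed by the subsets of `{0, …, m-1}`: its entry `a_{S,T}` is the
number of perfect matchings of the cycle after the removal of the vertices given by `S`, `T`. -/
noncomputable def transferMatrix (m : ℕ) : Matrix (Finset (Fin m)) (Finset (Fin m)) ℝ :=
  Matrix.of fun S T =>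
    (numPerfectMatchings ((layerCycle m).induce (layerRemaining m S T)) : ℝ)

/-- Sector `p`: the block of the transfer matrix indexed by the subsets with `p` elements. -/
noncomputable def sectorBlock (m p : ℕ) :
    Matrix {S : Finset (Fin m) // S.card = p} {S : Finset (Fin m) // S.card = p} ℝ :=
  (transferMatrix m).submatrix Subtype.val Subtype.val

/-- `x` is the largest eigenvalue of the real square matrix `M`, in the Perron–Frobenius sense:
it is a real eigenvalue, and no complex eigenvalue has larger modulus. -/
def IsLargestEigenvalue {n : Type*} [Fintype n] [DecidableEq n] (M : Matrix n n ℝ) (x : ℝ) :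
    Prop :=
  Module.End.HasEigenvalue (Matrix.toLin' M) x ∧
    ∀ μ : ℂ, Module.End.HasEigenvalue (Matrix.toLin' (M.map (fun a : ℝ => (a : ℂ)))) μ → ‖μ‖ ≤ x

/-- The explicit value `λ_max^{(p)}`, with `p / 2 = q` for `p = 2q` and for `p = 2q + 1`. -/
noncomputable def lamMax (m p : ℕ) : ℝ :=
  if Even p then
    2 / ∏ r ∈ Finset.range (p / 2), (4 * Real.sin (Real.pi * (2 * (r : ℝ) + 1) / (2 * (m : ℝ))) ^ 2)
  else
    (m : ℝ) / ∏ r ∈ Finset.Icc 1 (p / 2), (4 * Real.sin (Real.pi * (r : ℝ) / (m : ℝ)) ^ 2)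

/-- The dominant sector `p₀ = m - 2⌊(m+1)/3⌋` (a true subtraction as soon as `m ≥ 2`). -/
def dominantSector (m : ℕ) : ℕ := m - 2 * ((m + 1) / 3)

/-! In each slice, the `n = m - p` heights without a horizontal edge of the matching are read as
particles on a cycle with `m` sites. Across a layer every particle either keeps its height or drops
by one modulo `m`, and no two particles may land on the same site (`card_layerMatching`). Hence `p`
is conserved, and the transfer matrix is a hopping matrix of free fermions.

A positive eigenvector is the Vandermonde modulus of the particles, the product of `|2 sin(π(x -
y)/m)|` over all pairs. The signed product is, up to a constant, the determinant of a matrix `P(x)`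
of exponentials. By multilinearity, summing over all hops gives the determinant of `P(x) + P(x -
h)`, and this matrix is `P(x - h/2)` times a diagonal matrix of cosines (`sum_sinProd_piecewise`).
Collisions contribute zero and the other hops preserve the cyclic order, so no signs appear
(`transferMatrix_mulVec_rootVandermonde`). A positive eigenvector belongs to the largest eigenvalue
(`isLargestEigenvalue_of_pos`), here the product `cosProd n (π/m)`.

Cutting the barrel along its slices turns the number of matchings into `g ⬝ A^(k+1) g`, where `g`
counts matchings of an end polygon; this forces `n` to be even. In each sector, `g` lies below a
multiple of the eigenvector, which gives the upper bound. For the lower bound, `A` is symmetric on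
rotation invariant vectors, so Cauchy–Schwarz against the eigenvector suffices, without
irreducibility (`exists_le_card`). Finally, the ratio of the eigenvalues for `n + 2` and `n` is `(2
cos(π(n+1)/(2m)))²`, which crosses 1 once and never equals 1 for even `n`. So a single sector
dominates strictly. -/

/-! ### Perfect matchings as sets of edge labels -/

/-- Exactly one of three propositions holds. -/
def ExactlyOne (a b c : Prop) : Prop :=
  (a ∧ ¬b ∧ ¬c) ∨ (¬a ∧ b ∧ ¬c) ∨ (¬a ∧ ¬b ∧ c)

theorem existsUnique_iff_exactlyOne {E : Type*} {X : Set E} {I : E → Prop} {a b c : E}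
    (hab : a ≠ b) (hac : a ≠ c) (hbc : b ≠ c) (hI : ∀ e, I e ↔ e = a ∨ e = b ∨ e = c) :
    (∃! e, e ∈ X ∧ I e) ↔ ExactlyOne (a ∈ X) (b ∈ X) (c ∈ X) := by
  simp only [hI]
  constructor
  · rintro ⟨e, ⟨heX, he⟩, hu⟩
    have ha : a ∈ X → a = e := fun h => hu a ⟨h, Or.inl rfl⟩
    have hb : b ∈ X → b = e := fun h => hu b ⟨h, Or.inr (Or.inl rfl)⟩
    have hc : c ∈ X → c = e := fun h => hu c ⟨h, Or.inr (Or.inr rfl)⟩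
    unfold ExactlyOne
    grind
  · rintro (h | h | h)
    · exact ⟨a, ⟨h.1, Or.inl rfl⟩, by grind⟩
    · exact ⟨b, ⟨h.2.1, Or.inr (Or.inl rfl)⟩, by grind⟩
    · exact ⟨c, ⟨h.2.2, Or.inr (Or.inr rfl)⟩, by grind⟩

/-- Here `p` says that the vertex has been removed. Removal plays the role of a third edge, so
removed and remaining vertices obey the same rule. -/
theorem existsUnique_iff_exactlyOne_of_mem {E : Type*} {X : Set E} {I : E → Prop} {p : Prop}
    {b c : E} (hbc : b ≠ c) (hI : ∀ e, I e ↔ e = b ∨ e = c) :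
    ((¬p → ∃! e, e ∈ X ∧ I e) ∧ ∀ e ∈ X, I e → ¬p) ↔ ExactlyOne p (b ∈ X) (c ∈ X) := by
  simp only [hI]
  by_cases hp : p
  · simp only [hp, not_true, false_imp_iff, true_and, ExactlyOne, false_and, or_false]
    grind
  · simp only [hp, not_false_eq_true, true_imp_iff, imp_true_iff, and_true, ExactlyOne, false_and,
      true_and, false_or]
    constructor
    · rintro ⟨e, ⟨heX, he⟩, hu⟩
      have hb : b ∈ X → b = e := fun h => hu b ⟨h, Or.inl rfl⟩
      have hc : c ∈ X → c = e := fun h => hu c ⟨h, Or.inr rfl⟩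
      grind
    · rintro (h | h)
      · exact ⟨b, ⟨h.1, Or.inl rfl⟩, by grind⟩
      · exact ⟨c, ⟨h.2, Or.inr rfl⟩, by grind⟩

/-- The perfect matchings of a graph whose edges are labelled injectively by `E`, in a larger
vertex set, as sets of labels covering each vertex of the graph exactly once. -/
def perfectMatchingEquiv {V W E : Type*} (G : SimpleGraph V) (i : V → W)
    (hi : Function.Injective i) (ends : E → Sym2 W) (hends : Function.Injective ends)
    (hG : ∀ x y, G.Adj x y ↔ ∃ e, ends e = s(i x, i y)) :
    PerfectMatching G ≃ {X : Set E // (∀ x, ∃! e, e ∈ X ∧ i x ∈ ends e) ∧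
      ∀ e ∈ X, ∀ v ∈ ends e, v ∈ Set.range i} where
  toFun M := ⟨{e | ∃ x y, M.1.Adj x y ∧ ends e = s(i x, i y)}, by
    constructor
    · intro x
      obtain ⟨y, hxy, hu⟩ := M.2.1 (M.2.2 x)
      obtain ⟨e, he⟩ := (hG x y).1 hxy.adj_sub
      refine ⟨e, ⟨⟨x, y, hxy, he⟩, by simp [he]⟩, ?_⟩
      rintro e' ⟨⟨a, b, hab, he'⟩, hx⟩
      apply hends
      rw [he, he']
      rw [he', Sym2.mem_iff] at hx
      rcases hx with h | h
      · obtain rfl := hi h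
        rw [hu b hab]
      · obtain rfl := hi h
        rw [hu a hab.symm, Sym2.eq_swap]
    · rintro e ⟨x, y, -, he⟩ v hv
      rw [he, Sym2.mem_iff] at hv
      rcases hv with rfl | rfl <;> exact ⟨_, rfl⟩⟩
  invFun X := ⟨{ verts := Set.univ
                 Adj := fun x y => ∃ e ∈ X.1, ends e = s(i x, i y)
                 adj_sub := fun {x y} h => (hG x y).2 ⟨h.choose, h.choose_spec.2⟩
                 edge_vert := fun _ => Set.mem_univ _
                 symm := ⟨fun _ _ ⟨e, he, h⟩ => ⟨e, he, h.trans Sym2.eq_swap⟩⟩ }, by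
    refine ⟨fun x _ => ?_, fun x => Set.mem_univ x⟩
    obtain ⟨e, ⟨heX, hxe⟩, hu⟩ := X.2.1 x
    obtain ⟨v, hv⟩ := Sym2.mem_iff_exists.1 hxe
    obtain ⟨y, rfl⟩ := X.2.2 e heX v (by simp [hv])
    refine ⟨y, ⟨e, heX, hv⟩, ?_⟩
    rintro y' ⟨e', he', h⟩
    obtain rfl := hu e' ⟨he', by simp [h]⟩
    exact hi (Sym2.congr_right.1 (h.symm.trans hv))⟩
  left_inv M := by
    apply Subtype.ext
    refine SimpleGraph.Subgraph.ext (Set.eq_univ_of_forall M.2.2).symm ?_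
    ext x y
    constructor
    · rintro ⟨e, ⟨a, b, hab, he⟩, h⟩
      rw [he, Sym2.eq_iff] at h
      rcases h with ⟨h1, h2⟩ | ⟨h1, h2⟩
      · rwa [hi h1, hi h2] at hab
      · rw [hi h1, hi h2] at hab
        exact hab.symm
    · intro h
      obtain ⟨e, he⟩ := (hG x y).1 h.adj_sub
      exact ⟨e, ⟨x, y, h, he⟩, he⟩
  right_inv X := by
    apply Subtype.ext
    ext e
    constructor
    · rintro ⟨x, y, ⟨e', he', h'⟩, h⟩
      rwa [hends (h.trans h'.symm)]
    · intro he
      obtain ⟨⟨v, w⟩, hvw⟩ := Quot.exists_rep (ends e)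
      have hvw' : ends e = s(v, w) := hvw.symm
      obtain ⟨x, rfl⟩ := X.2.2 e he v (by simp [hvw'])
      obtain ⟨y, rfl⟩ := X.2.2 e he w (by simp [hvw'])
      exact ⟨x, y, ⟨e, he, hvw'⟩, hvw'⟩

theorem perfectMatchingEquiv_mem {V W E : Type*} (G : SimpleGraph V) (i : V → W)
    (hi : Function.Injective i) (ends : E → Sym2 W) (hends : Function.Injective ends)
    (hG : ∀ x y, G.Adj x y ↔ ∃ e, ends e = s(i x, i y)) (M : PerfectMatching G) {e : E} {x y : V}
    (he : ends e = s(i x, i y)) :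
    e ∈ (perfectMatchingEquiv G i hi ends hends hG M).1 ↔ M.1.Adj x y := by
  constructor
  · rintro ⟨a, b, hab, h⟩
    rw [he, Sym2.eq_iff] at h
    rcases h with ⟨h1, h2⟩ | ⟨h1, h2⟩
    · rwa [hi h1, hi h2]
    · rw [hi h1, hi h2]
      exact hab.symm
  · exact fun h => ⟨x, y, h, he⟩

/-! ### Matchings of the layers and of the end polygons -/

/-- A perfect matching of the layer cycle after removal of `S` and `T`, given by the set of edges
joining equal heights and the set of the other edges. -/
abbrev LayerMatching (m : ℕ) (S T : Finset (Fin m)) : Type :=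
  {DU : Set (Fin m) × Set (Fin m) //
    (∀ l, ExactlyOne (l ∈ S) (l ∈ DU.1) ((finRotate m).symm l ∈ DU.2)) ∧
    ∀ l, ExactlyOne (l ∈ T) (l ∈ DU.1) (l ∈ DU.2)}

/-- A perfect matching of the `m`-gon after removal of `S`, given by the set of lower endpoints
of its edges. -/
abbrev GonMatching (m : ℕ) (S : Finset (Fin m)) : Type :=
  {L : Set (Fin m) // ∀ l, ExactlyOne (l ∈ S) (l ∈ L) ((finRotate m).symm l ∈ L)}

theorem val_finRotate {m : ℕ} (l : Fin m) :
    (finRotate m l : ℕ) = if (l : ℕ) + 1 = m then 0 else (l : ℕ) + 1 := by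
  obtain _ | n := m
  · exact l.elim0
  · rw [coe_finRotate]
    simp [Fin.ext_iff]

theorem finRotate_ne_self {m : ℕ} (hm : 3 ≤ m) (l : Fin m) : finRotate m l ≠ l := by
  refine Fin.ne_of_val_ne ?_
  rw [val_finRotate]
  split_ifs <;> omega

theorem finRotate_finRotate_ne_self {m : ℕ} (hm : 3 ≤ m) (l : Fin m) :
    finRotate m (finRotate m l) ≠ l := by
  refine Fin.ne_of_val_ne ?_
  rw [val_finRotate, val_finRotate]
  split_ifs <;> omega

/-- The edges of the layer cycle. -/
def layerEnds (m : ℕ) : Fin m ⊕ Fin m → Sym2 (Fin m ⊕ Fin m)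
  | Sum.inl l => s(Sum.inl l, Sum.inr l)
  | Sum.inr l => s(Sum.inl (finRotate m l), Sum.inr l)

theorem layerEnds_injective {m : ℕ} (hm : 3 ≤ m) : Function.Injective (layerEnds m) := by
  rintro (a | a) (b | b) h <;>
    simp only [layerEnds, Sym2.eq_iff, Sum.inl.injEq, Sum.inr.injEq, reduceCtorEq, false_and,
      or_false] at h
  · rw [h.1]
  · exact absurd (h.1.symm.trans h.2) (finRotate_ne_self hm b)
  · exact absurd (h.1.trans h.2.symm) (finRotate_ne_self hm a)
  · rw [h.2]

theorem layerCycle_adj_iff (m : ℕ) (x y : Fin m ⊕ Fin m) :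
    (layerCycle m).Adj x y ↔ ∃ e, layerEnds m e = s(x, y) := by
  rw [layerCycle, SimpleGraph.fromRel_adj]
  constructor
  · rintro ⟨-, ⟨l, rfl, rfl | rfl⟩ | ⟨l, rfl, rfl | rfl⟩⟩
    · exact ⟨Sum.inl l, rfl⟩
    · exact ⟨Sum.inr l, rfl⟩
    · exact ⟨Sum.inl l, Sym2.eq_swap⟩
    · exact ⟨Sum.inr l, Sym2.eq_swap⟩
  · rintro ⟨e | e, h⟩ <;> rw [layerEnds, Sym2.eq_iff] at h <;>
      rcases h with ⟨rfl, rfl⟩ | ⟨rfl, rfl⟩ <;> simp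

theorem transferMatrix_apply {m : ℕ} (hm : 3 ≤ m) (S T : Finset (Fin m)) :
    transferMatrix m S T = Nat.card (LayerMatching m S T) := by
  have hG : ∀ x y : layerRemaining m S T,
      ((layerCycle m).induce (layerRemaining m S T)).Adj x y ↔
        ∃ e, layerEnds m e = s((x : Fin m ⊕ Fin m), (y : Fin m ⊕ Fin m)) := by
    intro x y
    rw [SimpleGraph.induce_adj, layerCycle_adj_iff]
  have hinl : ∀ (l : Fin m) (e : Fin m ⊕ Fin m), Sum.inl l ∈ layerEnds m e ↔
      e = Sum.inl l ∨ e = Sum.inr ((finRotate m).symm l) := by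
    rintro l (e | e) <;>
      simp [layerEnds, eq_comm, Equiv.eq_symm_apply, -finRotate_apply, -finRotate_symm_apply]
  have hinr : ∀ (l : Fin m) (e : Fin m ⊕ Fin m), Sum.inr l ∈ layerEnds m e ↔
      e = Sum.inl l ∨ e = Sum.inr l := by
    rintro l (e | e) <;> simp [layerEnds, eq_comm]
  rw [transferMatrix, Matrix.of_apply, numPerfectMatchings, Nat.cast_inj]
  refine Nat.card_congr (((perfectMatchingEquiv _ Subtype.val Subtype.val_injective (layerEnds m)
    (layerEnds_injective hm) hG)).trans
      ((Set.sumEquiv.toEquiv : Set (Fin m ⊕ Fin m) ≃ _).subtypeEquiv ?_))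
  intro X
  have hsplit : ((∀ x : layerRemaining m S T, ∃! e, e ∈ X ∧ x.1 ∈ layerEnds m e) ∧
      ∀ e ∈ X, ∀ v ∈ layerEnds m e, v ∈ Set.range (Subtype.val : layerRemaining m S T → _)) ↔
      ∀ v, (¬ v ∉ layerRemaining m S T → ∃! e, e ∈ X ∧ v ∈ layerEnds m e) ∧
        ∀ e ∈ X, v ∈ layerEnds m e → ¬ v ∉ layerRemaining m S T := by
    simp only [Subtype.range_coe, not_not, forall_and]
    exact and_congr ⟨fun h v hv => h ⟨v, hv⟩, fun h v => h v.1 v.2⟩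
      ⟨fun h v e he hv => h e he v hv, fun h e he v hv => h v e he hv⟩
  rw [hsplit, Sum.forall]
  have hS : ∀ l, Sum.inl l ∉ layerRemaining m S T ↔ l ∈ S := by simp [layerRemaining]
  have hT : ∀ l, Sum.inr l ∉ layerRemaining m S T ↔ l ∈ T := by simp [layerRemaining]
  refine and_congr (forall_congr' fun l => ?_) (forall_congr' fun l => ?_)
  · rw [existsUnique_iff_exactlyOne_of_mem Sum.inl_ne_inr (hinl l), hS]
    rfl
  · rw [existsUnique_iff_exactlyOne_of_mem Sum.inl_ne_inr (hinr l), hT]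
    rfl

/-! ### Cutting a matching of the barrel along its slices -/

/-- Labels for the edges of the barrel fullerene. -/
inductive BarrelLabel (m k : ℕ) : Type
  | horizontal (j : Fin (k + 2)) (l : Fin m)
  | below (j : Fin (k + 1)) (l : Fin m)
  | above (j : Fin (k + 1)) (l : Fin m)
  | left (l : Fin m)
  | right (l : Fin m)

/-- The endpoints of the edges of the barrel fullerene. -/
def barrelEnds {m k : ℕ} : BarrelLabel m k → Sym2 (BarrelVertex m k)
  | .horizontal j l => s((j, l, false), (j, l, true))
  | .below j l => s((j.castSucc, l, true), (j.succ, l, false))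
  | .above j l => s((j.castSucc, finRotate m l, true), (j.succ, l, false))
  | .left l => s((0, l, false), (0, finRotate m l, false))
  | .right l => s((Fin.last (k + 1), l, true), (Fin.last (k + 1), finRotate m l, true))

/-- The bound `3 ≤ m` matters for the end polygons: for `m = 2` their two edges would have the same
endpoints. -/
theorem barrelEnds_injective {m : ℕ} (hm : 3 ≤ m) (k : ℕ) :
    Function.Injective (barrelEnds (m := m) (k := k)) := by
  have h1 := finRotate_ne_self hm
  have h2 := finRotate_finRotate_ne_self hm
  have h3 : ∀ j : Fin (k + 1), j.castSucc ≠ j.succ := fun j => (Fin.castSucc_lt_succ).ne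
  rintro (⟨j, l⟩ | ⟨j, l⟩ | ⟨j, l⟩ | l | l) (⟨j', l'⟩ | ⟨j', l'⟩ | ⟨j', l'⟩ | l' | l') h <;>
    simp only [barrelEnds, Sym2.eq_iff, Prod.mk.injEq, reduceCtorEq, and_false, or_false,
      and_true, false_or, false_and] at h <;> grind

theorem barrelFullerene_adj_iff {m : ℕ} (hm : 3 ≤ m) (k : ℕ) (x y : BarrelVertex m k) :
    (barrelFullerene m k).Adj x y ↔ ∃ e, barrelEnds e = s(id x, id y) := by
  have h1 := finRotate_ne_self hm
  have h3 : ∀ j : Fin (k + 1), j.castSucc ≠ j.succ := fun j => (Fin.castSucc_lt_succ).ne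
  have key : ∀ x y, BarrelEdge m k x y ↔ ∃ e : BarrelLabel m k, barrelEnds e = s(x, y) ∧
      BarrelEdge m k x y := by
    intro x y
    refine ⟨fun h => ?_, fun ⟨_, _, h⟩ => h⟩
    cases h with
    | horizontal j l => exact ⟨.horizontal j l, rfl, .horizontal j l⟩
    | below j l => exact ⟨.below j l, rfl, .below j l⟩
    | above j l => exact ⟨.above j l, rfl, .above j l⟩
    | leftGon l => exact ⟨.left l, rfl, .leftGon l⟩
    | rightGon l => exact ⟨.right l, rfl, .rightGon l⟩
  rw [barrelFullerene, SimpleGraph.fromRel_adj, id, id]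
  constructor
  · rintro ⟨-, h | h⟩
    · obtain ⟨e, he, -⟩ := (key x y).1 h
      exact ⟨e, he⟩
    · obtain ⟨e, he, -⟩ := (key y x).1 h
      exact ⟨e, he.trans Sym2.eq_swap⟩
  · rintro ⟨e, h⟩
    have hE : ∀ e : BarrelLabel m k, ∃ a b, a ≠ b ∧ BarrelEdge m k a b ∧
        barrelEnds e = s(a, b) := by
      rintro (⟨j, l⟩ | ⟨j, l⟩ | ⟨j, l⟩ | l | l)
      · exact ⟨_, _, by simp, .horizontal j l, rfl⟩
      · exact ⟨_, _, by simp, .below j l, rfl⟩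
      · exact ⟨_, _, by simp, .above j l, rfl⟩
      · exact ⟨_, _, by simpa using (h1 l).symm, .leftGon l, rfl⟩
      · exact ⟨_, _, by simpa using (h1 l).symm, .rightGon l, rfl⟩
    obtain ⟨a, b, hab, hE, he⟩ := hE e
    rw [he, Sym2.eq_iff] at h
    rcases h with ⟨rfl, rfl⟩ | ⟨rfl, rfl⟩
    · exact ⟨hab, Or.inl hE⟩
    · exact ⟨hab.symm, Or.inr hE⟩

/-- Every vertex has three edges, one of them horizontal. Once the horizontal edges are fixed, each
condition involves a single layer or a single end polygon, so the pieces become independent. -/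
theorem existsUnique_barrelEnds_iff {m : ℕ} (hm : 3 ≤ m) {k : ℕ} (X : Set (BarrelLabel m k)) :
    (∀ v, ∃! e, e ∈ X ∧ id v ∈ barrelEnds e) ↔
      (∀ l, ExactlyOne (.horizontal 0 l ∈ X) (.left l ∈ X) (.left ((finRotate m).symm l) ∈ X)) ∧
      (∀ j l, ExactlyOne (.horizontal (Fin.castSucc j) l ∈ X) (.below j l ∈ X)
          (.above j ((finRotate m).symm l) ∈ X) ∧
        ExactlyOne (.horizontal (Fin.succ j) l ∈ X) (.below j l ∈ X) (.above j l ∈ X)) ∧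
      ∀ l, ExactlyOne (.horizontal (Fin.last (k + 1)) l ∈ X) (.right l ∈ X)
        (.right ((finRotate m).symm l) ∈ X) := by
  have hρ : ∀ l, l ≠ (finRotate m).symm l := fun l h =>
    finRotate_ne_self hm l ((Equiv.eq_symm_apply _).1 h)
  have h0 : ∀ j : Fin (k + 1), j.succ ≠ 0 := fun j => Fin.succ_ne_zero j
  have hl : ∀ j : Fin (k + 1), j.castSucc ≠ Fin.last (k + 1) := fun j => (Fin.castSucc_lt_last j).ne
  have hsymm : ∀ l l', l = finRotate m l' ↔ l' = (finRotate m).symm l := fun l l' => by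
    rw [Equiv.eq_symm_apply, eq_comm]
  have e1 : ∀ l, (∃! e, e ∈ X ∧ ((0, l, false) : BarrelVertex m k) ∈ barrelEnds e) ↔
      ExactlyOne (.horizontal 0 l ∈ X) (.left l ∈ X) (.left ((finRotate m).symm l) ∈ X) := by
    intro l
    refine existsUnique_iff_exactlyOne (by simp) (by simp) (by simpa using hρ l) ?_
    rintro (⟨j', l'⟩ | ⟨j', l'⟩ | ⟨j', l'⟩ | l' | l') <;>
    simp [barrelEnds, eq_comm, -finRotate_apply, -finRotate_symm_apply, hsymm, h0]
  have e2 : ∀ j l, (∃! e, e ∈ X ∧ ((Fin.succ j, l, false) : BarrelVertex m k) ∈ barrelEnds e) ↔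
      ExactlyOne (.horizontal (Fin.succ j) l ∈ X) (.below j l ∈ X) (.above j l ∈ X) := by
    intro j l
    refine existsUnique_iff_exactlyOne (by simp) (by simp) (by simp) ?_
    rintro (⟨j', l'⟩ | ⟨j', l'⟩ | ⟨j', l'⟩ | l' | l') <;>
    simp [barrelEnds, eq_comm, -finRotate_apply, -finRotate_symm_apply]
  have e3 : ∀ j l, (∃! e, e ∈ X ∧ ((Fin.castSucc j, l, true) : BarrelVertex m k) ∈ barrelEnds e) ↔
      ExactlyOne (.horizontal (Fin.castSucc j) l ∈ X) (.below j l ∈ X)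
          (.above j ((finRotate m).symm l) ∈ X) := by
    intro j l
    refine existsUnique_iff_exactlyOne (by simp) (by simp) (by simp) ?_
    rintro (⟨j', l'⟩ | ⟨j', l'⟩ | ⟨j', l'⟩ | l' | l') <;>
    simp [barrelEnds, eq_comm, -finRotate_apply, -finRotate_symm_apply, hsymm]
  have e4 : ∀ l, (∃! e, e ∈ X ∧ ((Fin.last (k + 1), l, true) : BarrelVertex m k) ∈ barrelEnds e) ↔
      ExactlyOne (.horizontal (Fin.last (k + 1)) l ∈ X) (.right l ∈ X)
        (.right ((finRotate m).symm l) ∈ X) := by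
    intro l
    refine existsUnique_iff_exactlyOne (by simp) (by simp) (by simpa using hρ l) ?_
    rintro (⟨j', l'⟩ | ⟨j', l'⟩ | ⟨j', l'⟩ | l' | l') <;>
    simp [barrelEnds, eq_comm, -finRotate_apply, -finRotate_symm_apply, hsymm, hl]
  constructor
  · intro h
    exact ⟨fun l => (e1 l).1 (h _), fun j l => ⟨(e3 j l).1 (h _), (e2 j l).1 (h _)⟩,
      fun l => (e4 l).1 (h _)⟩
  · rintro ⟨h1, h2, h3⟩ ⟨j, l, _ | _⟩
    · induction j using Fin.cases with
      | zero => exact (e1 l).2 (h1 l)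
      | succ j => exact (e2 j l).2 (h2 j l).2
    · induction j using Fin.lastCases with
      | last => exact (e4 l).2 (h3 l)
      | cast j => exact (e3 j l).2 (h2 j l).1

/-- The heights of the horizontal edges of a perfect matching in slice `j`. -/
noncomputable def horizontalSet {m k : ℕ} (M : PerfectMatching (barrelFullerene m k))
    (j : Fin (k + 2)) : Finset (Fin m) :=
  open Classical in Finset.univ.filter fun l => M.1.Adj (j, l, false) (j, l, true)

theorem card_horizontalSet {m k : ℕ} (M : PerfectMatching (barrelFullerene m k))
    (j : Fin (k + 2)) : (horizontalSet M j).card = horizontalCount M j := by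
  classical
  rw [horizontalCount, Nat.card_eq_fintype_card, Fintype.card_subtype, horizontalSet]

/-- The ways to complete given sets of horizontal edges to a perfect matching. -/
abbrev SliceCompletion {m k : ℕ} (H : Fin (k + 2) → Finset (Fin m)) : Type :=
  GonMatching m (H 0) × (∀ j : Fin (k + 1), LayerMatching m (H j.castSucc) (H j.succ)) ×
    GonMatching m (H (Fin.last (k + 1)))

/-- Perfect matchings with prescribed horizontal edges are made of independent pieces. -/
theorem card_horizontalSet_eq {m : ℕ} (hm : 3 ≤ m) {k : ℕ} (H : Fin (k + 2) → Finset (Fin m)) :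
    Nat.card {M : PerfectMatching (barrelFullerene m k) // horizontalSet M = H} =
      Nat.card (SliceCompletion H) := by
  let φ := perfectMatchingEquiv (barrelFullerene m k) id Function.injective_id barrelEnds
    (barrelEnds_injective hm k) (barrelFullerene_adj_iff hm k)
  have hφ : ∀ M, horizontalSet M = H ↔ ∀ j l, (.horizontal j l ∈ (φ M).1 ↔ l ∈ H j) := by
    intro M
    rw [funext_iff]
    refine forall_congr' fun j => ?_
    rw [Finset.ext_iff]
    refine forall_congr' fun l => ?_
    rw [perfectMatchingEquiv_mem (barrelFullerene m k) id Function.injective_id barrelEnds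
      (barrelEnds_injective hm k) (barrelFullerene_adj_iff hm k) M (x := (j, l, false))
      (y := (j, l, true)) rfl]
    simp [horizontalSet]
  refine Nat.card_congr ((φ.subtypeEquiv (q := fun X => ∀ j l, (.horizontal j l ∈ X.1 ↔ l ∈ H j))
    hφ).trans ?_)
  refine
    { toFun := fun X =>
        (⟨{l | .left l ∈ X.1.1}, fun l => ?_⟩,
          fun j => ⟨({l | .below j l ∈ X.1.1}, {l | .above j l ∈ X.1.1}), fun l => ?_, fun l => ?_⟩,
          ⟨{l | .right l ∈ X.1.1}, fun l => ?_⟩)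
      invFun := fun c => ⟨⟨fun e => match e with
        | .horizontal j l => l ∈ H j
        | .below j l => l ∈ (c.2.1 j).1.1
        | .above j l => l ∈ (c.2.1 j).1.2
        | .left l => l ∈ c.1.1
        | .right l => l ∈ c.2.2.1, ?_, fun e _ v _ => ⟨v, rfl⟩⟩, fun j l => Iff.rfl⟩
      left_inv := fun X => ?_
      right_inv := fun c => rfl }
  · rw [← X.2]
    exact ((existsUnique_barrelEnds_iff hm X.1.1).1 X.1.2.1).1 l
  · rw [← X.2]
    exact (((existsUnique_barrelEnds_iff hm X.1.1).1 X.1.2.1).2.1 j l).1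
  · rw [← X.2]
    exact (((existsUnique_barrelEnds_iff hm X.1.1).1 X.1.2.1).2.1 j l).2
  · rw [← X.2]
    exact ((existsUnique_barrelEnds_iff hm X.1.1).1 X.1.2.1).2.2 l
  · exact (existsUnique_barrelEnds_iff hm _).2 ⟨fun l => c.1.2 l,
      fun j l => ⟨(c.2.1 j).2.1 l, (c.2.1 j).2.2 l⟩, fun l => c.2.2.2 l⟩
  · apply Subtype.ext
    apply Subtype.ext
    ext e
    cases e with
    | horizontal j l => exact (X.2 j l).symm
    | below j l => exact Iff.rfl
    | above j l => exact Iff.rfl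
    | left l => exact Iff.rfl
    | right l => exact Iff.rfl

theorem card_sliceCompletion {m : ℕ} (hm : 3 ≤ m) {k : ℕ} (H : Fin (k + 2) → Finset (Fin m)) :
    (Nat.card (SliceCompletion H) : ℝ) = Nat.card (GonMatching m (H 0)) *
      (∏ j : Fin (k + 1), transferMatrix m (H j.castSucc) (H j.succ)) *
      Nat.card (GonMatching m (H (Fin.last (k + 1)))) := by
  simp only [Nat.card_prod, Nat.card_pi, Nat.cast_mul, Nat.cast_prod, transferMatrix_apply hm]
  ring

/-! ### Conservation of the number of particles and rotation symmetry -/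

theorem card_add_ncard_of_exactlyOne {m : ℕ} {S : Finset (Fin m)} {D U : Set (Fin m)}
    (h : ∀ l, ExactlyOne (l ∈ S) (l ∈ D) (l ∈ U)) : S.card + D.ncard + U.ncard = m := by
  unfold ExactlyOne at h
  rw [← Set.ncard_coe_finset, ← Set.ncard_union_eq, ← Set.ncard_union_eq]
  · have : (S : Set (Fin m)) ∪ D ∪ U = Set.univ := by
      ext l
      have := h l
      simp only [Set.mem_union, Finset.mem_coe, Set.mem_univ, iff_true]
      tauto
    rw [this, Set.ncard_univ, Nat.card_fin]
  · rw [Set.disjoint_left]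
    intro l hl
    have := h l
    simp only [Set.mem_union, Finset.mem_coe] at hl
    tauto
  · rw [Set.disjoint_left]
    intro l hl
    have := h l
    simp only [Finset.mem_coe] at hl
    tauto

theorem ncard_finRotate_symm {m : ℕ} (U : Set (Fin m)) :
    {l | (finRotate m).symm l ∈ U}.ncard = U.ncard :=
  Set.ncard_preimage_of_injective_subset_range (f := (finRotate m).symm)
    (Equiv.injective _) (by simp)

/-- The layer cycle is bipartite with `m` vertices on each side, and every edge uses one vertex of
each side. -/
theorem card_eq_of_layerMatching {m : ℕ} {S T : Finset (Fin m)} (X : LayerMatching m S T) :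
    S.card = T.card := by
  have h1 := card_add_ncard_of_exactlyOne (U := {l | (finRotate m).symm l ∈ X.1.2}) X.2.1
  have h2 := card_add_ncard_of_exactlyOne X.2.2
  rw [ncard_finRotate_symm] at h1
  omega

theorem even_of_gonMatching {m : ℕ} {S : Finset (Fin m)} (X : GonMatching m S) :
    Even (m - S.card) := by
  have h := card_add_ncard_of_exactlyOne (U := {l | (finRotate m).symm l ∈ X.1}) X.2
  rw [ncard_finRotate_symm] at h
  exact ⟨X.1.ncard, by omega⟩

theorem transferMatrix_eq_zero {m : ℕ} (hm : 3 ≤ m) {S T : Finset (Fin m)}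
    (h : S.card ≠ T.card) : transferMatrix m S T = 0 := by
  have : IsEmpty (LayerMatching m S T) := ⟨fun X => h (card_eq_of_layerMatching X)⟩
  rw [transferMatrix_apply hm, Nat.card_of_isEmpty, Nat.cast_zero]

theorem transferMatrix_nonneg (m : ℕ) (S T : Finset (Fin m)) : 0 ≤ transferMatrix m S T :=
  Nat.cast_nonneg _

theorem one_le_transferMatrix_self {m : ℕ} (hm : 3 ≤ m) (S : Finset (Fin m)) :
    1 ≤ transferMatrix m S S := by
  have : Nonempty (LayerMatching m S S) :=
    ⟨⟨({l | l ∉ S}, ∅), fun l => by simp [ExactlyOne, em], fun l => by simp [ExactlyOne, em]⟩⟩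
  rw [transferMatrix_apply hm]
  exact_mod_cast Nat.card_pos

/-- The rotation of a set of heights by one step. -/
def rotateSet {m : ℕ} : Finset (Fin m) ≃ Finset (Fin m) := (finRotate m).finsetCongr

theorem mem_rotateSet {m : ℕ} {S : Finset (Fin m)} {l : Fin m} :
    l ∈ rotateSet S ↔ (finRotate m).symm l ∈ S := by
  simp [rotateSet, Equiv.finsetCongr_apply, Finset.mem_map_equiv]

theorem card_rotateSet {m : ℕ} (S : Finset (Fin m)) : (rotateSet S).card = S.card := by
  simp [rotateSet]

/-- The two sides of the cycle are staggered by half a step, so the reflection exchanging them is a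
symmetry up to one rotation. It swaps the two kinds of edges. -/
theorem transferMatrix_rotateSet {m : ℕ} (hm : 3 ≤ m) (S T : Finset (Fin m)) :
    transferMatrix m (rotateSet S) T = transferMatrix m T S := by
  rw [transferMatrix_apply hm, transferMatrix_apply hm, Nat.cast_inj]
  have hswap : ∀ {a b c : Prop}, ExactlyOne a b c ↔ ExactlyOne a c b := by
    unfold ExactlyOne; tauto
  refine Nat.card_congr
    { toFun := fun X => ⟨(X.1.2, {l | finRotate m l ∈ X.1.1}), fun l => ?_, fun l => ?_⟩
      invFun := fun X => ⟨({l | (finRotate m).symm l ∈ X.1.2}, X.1.1), fun l => ?_, fun l => ?_⟩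
      left_inv := fun X => ?_
      right_inv := fun X => ?_ }
  · simpa only [Set.mem_ofPred_eq, Equiv.apply_symm_apply] using hswap.1 (X.2.2 l)
  · simpa only [Set.mem_ofPred_eq, Equiv.symm_apply_apply, mem_rotateSet] using
      hswap.1 (X.2.1 (finRotate m l))
  · simpa only [mem_rotateSet, Set.mem_ofPred_eq] using hswap.1 (X.2.2 ((finRotate m).symm l))
  · exact hswap.1 (X.2.1 l)
  · simp [-finRotate_apply, -finRotate_symm_apply]
  · simp [-finRotate_apply, -finRotate_symm_apply]

/-- The number of perfect matchings of the `m`-gon after removal of `S`. -/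
noncomputable def gonCount (m : ℕ) (S : Finset (Fin m)) : ℝ := Nat.card (GonMatching m S)

theorem gonCount_nonneg (m : ℕ) (S : Finset (Fin m)) : 0 ≤ gonCount m S := Nat.cast_nonneg _

theorem gonCount_eq_zero {m : ℕ} {S : Finset (Fin m)} (h : ¬ Even (m - S.card)) :
    gonCount m S = 0 := by
  have : IsEmpty (GonMatching m S) := ⟨fun X => h (even_of_gonMatching X)⟩
  rw [gonCount, Nat.card_of_isEmpty, Nat.cast_zero]

theorem gonCount_rotateSet {m : ℕ} (S : Finset (Fin m)) :
    gonCount m (rotateSet S) = gonCount m S := by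
  rw [gonCount, gonCount, Nat.cast_inj]
  refine Nat.card_congr
    { toFun := fun X => ⟨{l | finRotate m l ∈ X.1}, fun l => ?_⟩
      invFun := fun X => ⟨{l | (finRotate m).symm l ∈ X.1}, fun l => ?_⟩
      left_inv := fun X => ?_
      right_inv := fun X => ?_ }
  · simpa only [Set.mem_ofPred_eq, Equiv.apply_symm_apply, Equiv.symm_apply_apply, mem_rotateSet]
      using X.2 (finRotate m l)
  · simpa only [mem_rotateSet, Set.mem_ofPred_eq] using X.2 ((finRotate m).symm l)
  · simp [-finRotate_apply, -finRotate_symm_apply]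
  · simp [-finRotate_apply, -finRotate_symm_apply]

theorem exists_gonCount_pos {m q : ℕ} (hq : 2 * q ≤ m) :
    ∃ S : Finset (Fin m), S.card = m - 2 * q ∧ 0 < gonCount m S := by
  -- The first `2 * q` heights are left and matched in consecutive pairs, each with an even lower
  -- endpoint.
  refine ⟨Finset.univ.filter fun l => ¬ (l : ℕ) < 2 * q, ?_, ?_⟩
  · rw [← Finset.compl_filter, Finset.card_compl, Fintype.card_fin, Fin.card_filter_val_lt,
      min_eq_right hq]
  · have : Nonempty (GonMatching m (Finset.univ.filter fun l => ¬ (l : ℕ) < 2 * q)) := by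
      refine ⟨⟨{l | (l : ℕ) < 2 * q ∧ Even (l : ℕ)}, fun l => ?_⟩⟩
      obtain ⟨x, rfl⟩ := (finRotate m).surjective l
      simp only [Equiv.symm_apply_apply, ExactlyOne, Finset.mem_filter, Finset.mem_univ, true_and,
        Set.mem_ofPred_eq, val_finRotate, Nat.even_iff]
      have := x.2
      split_ifs <;> omega
    rw [gonCount]
    exact_mod_cast Nat.card_pos

/-! ### Counting matchings by powers of the transfer matrix -/

theorem sum_path {α : Type*} [Fintype α] [DecidableEq α] (A : Matrix α α ℝ) (n : ℕ)
    (f g : α → ℝ) :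
    ∑ H : Fin (n + 1) → α, f (H 0) * (∏ j : Fin n, A (H j.castSucc) (H j.succ)) *
      g (H (Fin.last n)) = f ⬝ᵥ ((A ^ n).mulVec g) := by
  induction n generalizing f with
  | zero =>
    rw [pow_zero, Matrix.one_mulVec, dotProduct, ← (Equiv.funUnique (Fin 1) α).sum_comp]
    simp
  | succ n ih =>
    have h := ih (Matrix.vecMul f A)
    rw [← Matrix.dotProduct_mulVec, Matrix.mulVec_mulVec, ← pow_succ'] at h
    rw [← h, ← (Fin.consEquiv fun _ => α).sum_comp, Fintype.sum_prod_type, Finset.sum_comm]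
    refine Finset.sum_congr rfl fun H _ => ?_
    rw [Matrix.vecMul, dotProduct, Finset.sum_mul, Finset.sum_mul]
    refine Finset.sum_congr rfl fun s _ => ?_
    simp only [Fin.consEquiv_apply, Fin.cons_zero, Fin.prod_univ_succ, Fin.cons_succ,
      Fin.castSucc_zero, ← Fin.succ_castSucc, ← Fin.succ_last]
    ring

/-- The vector `gonCount` restricted to the sector `p`. -/
noncomputable def sectorGon (m p : ℕ) (S : Finset (Fin m)) : ℝ :=
  if S.card = p then gonCount m S else 0

/-- There are `k + 1` layers between the `k + 2` slices. Restricting the left end vector is enough,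
because the matrix does not connect different sectors. -/
theorem card_horizontalCount_eq {m : ℕ} (hm : 3 ≤ m) (k p : ℕ) :
    (Nat.card {M : PerfectMatching (barrelFullerene m k) // horizontalCount M 0 = p} : ℝ) =
      sectorGon m p ⬝ᵥ ((transferMatrix m ^ (k + 1)).mulVec (gonCount m)) := by
  rw [← sum_path, Nat.card_congr (Equiv.sigmaFiberEquiv
    fun M : {M : PerfectMatching (barrelFullerene m k) // horizontalCount M 0 = p} =>
      horizontalSet M.1).symm, Nat.card_sigma, Nat.cast_sum]
  refine Finset.sum_congr rfl fun H _ => ?_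
  by_cases hH : (H 0).card = p
  · rw [sectorGon, if_pos hH, gonCount, gonCount]
    refine Eq.trans ?_ (card_sliceCompletion hm H)
    rw [← card_horizontalSet_eq hm, Nat.cast_inj]
    refine Nat.card_congr (Equiv.subtypeSubtypeEquivSubtype (p := fun M => horizontalCount M 0 = p)
      (q := fun M => horizontalSet M = H) fun {M} h => ?_)
    rw [← card_horizontalSet, h, hH]
  · have : IsEmpty {M : {M : PerfectMatching (barrelFullerene m k) // horizontalCount M 0 = p} //
        horizontalSet M.1 = H} := by
      refine ⟨fun M => hH ?_⟩
      rw [← M.2, card_horizontalSet, M.1.2]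
    rw [sectorGon, if_neg hH, Nat.card_of_isEmpty]
    simp

theorem horizontalCount_eq {m : ℕ} (hm : 3 ≤ m) {k : ℕ}
    (M : PerfectMatching (barrelFullerene m k)) (j : Fin (k + 2)) :
    horizontalCount M j = horizontalCount M 0 := by
  have hpos : 0 < Nat.card (SliceCompletion (horizontalSet M)) := by
    rw [← card_horizontalSet_eq hm]
    have : Nonempty {N : PerfectMatching (barrelFullerene m k) //
      horizontalSet N = horizontalSet M} := ⟨⟨M, rfl⟩⟩
    exact Nat.card_pos
  obtain ⟨X⟩ := (Nat.card_pos_iff.1 hpos).1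
  induction j using Fin.induction with
  | zero => rfl
  | succ j ih =>
    rw [← ih, ← card_horizontalSet, ← card_horizontalSet]
    exact (card_eq_of_layerMatching (X.2.1 j)).symm

/-! ### Trigonometric Vandermonde products -/

/-- The product of `2 sin (x j - x i)` over all pairs `i < j`. -/
noncomputable def sinProd {n : ℕ} (x : Fin n → ℝ) : ℝ :=
  ∏ i, ∏ j ∈ Finset.Ioi i, 2 * Real.sin (x j - x i)

/-- The product of the `n` numbers `2 cos (h a / 2)`, for `a = -(n-1), -(n-3), …, n-1`. -/
noncomputable def cosProd (n : ℕ) (h : ℝ) : ℝ :=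
  ∏ a ∈ Finset.range n, 2 * Real.cos (h / 2 * (2 * (a : ℝ) - (n - 1)))

open Complex in
-- The homogeneous form makes the frequencies `2a - (n-1)` symmetric about zero; this is why the
-- eigenvalue becomes a product of real cosines without a phase.
theorem projVandermonde_exp_apply {n : ℕ} (x : Fin n → ℝ) (b a : Fin n) :
    Matrix.projVandermonde (fun b => exp (x b * I)) (fun b => exp (-(x b * I))) b a =
      exp ((2 * (a : ℂ) - (n - 1)) * (x b * I)) := by
  rw [Matrix.projVandermonde_apply, ← Complex.exp_nat_mul, ← Complex.exp_nat_mul, ← Complex.exp_add,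
    Fin.val_rev, Nat.cast_sub a.2]
  push_cast
  ring_nf

open Complex in
theorem det_projVandermonde_exp {n : ℕ} (x : Fin n → ℝ) :
    (Matrix.projVandermonde (fun b => exp (x b * I)) (fun b => exp (-(x b * I)))).det =
      (∏ i : Fin n, ∏ _j ∈ Finset.Ioi i, I) * (sinProd x : ℂ) := by
  rw [Matrix.det_projVandermonde, sinProd]
  push_cast
  simp only [← Finset.prod_mul_distrib]
  refine Finset.prod_congr rfl fun i _ => Finset.prod_congr rfl fun j _ => ?_
  rw [← Complex.exp_add, ← Complex.exp_add, Complex.two_sin,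
    show (x j : ℂ) * I + -(x i * I) = (x j - x i) * I by ring,
    show (x i : ℂ) * I + -(x j * I) = -(x j - x i) * I by ring]
  linear_combination (exp ((x j - x i) * I) - exp (-(x j - x i) * I)) * I_sq

open Complex in
/-- Hopping of free fermions: the sum of `sinProd` over all ways of moving some of the points by
`-h` is a multiple of `sinProd`. -/
theorem sum_sinProd_piecewise {n : ℕ} (x : Fin n → ℝ) (h : ℝ) :
    ∑ s : Finset (Fin n), sinProd (s.piecewise x fun b => x b - h) = cosProd n h * sinProd x := by
  set P : (Fin n → ℝ) → Matrix (Fin n) (Fin n) ℂ := fun x =>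
    Matrix.projVandermonde (fun b => exp (x b * I)) (fun b => exp (-(x b * I))) with hP
  have hdet : ∀ x, (P x).det = (∏ i : Fin n, ∏ _j ∈ Finset.Ioi i, I) * (sinProd x : ℂ) :=
    det_projVandermonde_exp
  have hc : (∏ i : Fin n, ∏ _j ∈ Finset.Ioi i, I) ≠ 0 :=
    Finset.prod_ne_zero_iff.2 fun i _ => Finset.prod_ne_zero_iff.2 fun j _ => I_ne_zero
  have h2 : ∀ s : Finset (Fin n), s.piecewise (P x) (P fun b => x b - h) =
      P (s.piecewise x fun b => x b - h) := by
    intro s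
    ext b a
    by_cases hb : b ∈ s <;> simp [hP, Finset.piecewise, hb, Matrix.projVandermonde_apply]
  -- For a frequency `f`, `exp(ifx) + exp(if(x-h)) = 2 cos(fh/2) exp(if(x-h/2))`; the cosine depends
  -- only on the column.
  have h3 : P x + P (fun b => x b - h) = P (fun b => x b - h / 2) *
      Matrix.diagonal fun a : Fin n => (2 * cos (h / 2 * (2 * (a : ℂ) - (n - 1)))) := by
    ext b a
    rw [Matrix.mul_diagonal, Matrix.add_apply, hP]
    simp only [projVandermonde_exp_apply]
    rw [Complex.two_cos, mul_add, ← Complex.exp_add, ← Complex.exp_add]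
    push_cast
    ring_nf
  -- Multilinearity in the rows: each row, that is each particle, chooses between staying and
  -- moving.
  have h1 : (P x + P fun b => x b - h).det =
      ∑ s : Finset (Fin n), (P (s.piecewise x fun b => x b - h)).det :=
    ((Matrix.detRowAlternating (R := ℂ) (n := Fin n)).map_add_univ _ _).trans
      (Finset.sum_congr rfl fun s _ => congrArg Matrix.det (h2 s))
  rw [h3, Matrix.det_mul, Matrix.det_diagonal] at h1
  have h5 : sinProd (fun b => x b - h / 2) = sinProd x := by
    simp [sinProd]
  simp only [hdet, h5, ← Finset.mul_sum] at h1
  rw [mul_assoc] at h1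
  have h4 := mul_left_cancel₀ hc h1
  apply Complex.ofReal_injective
  rw [cosProd, Finset.prod_range]
  push_cast
  rw [← h4, mul_comm]

/-- The modulus of the Vandermonde product of the `m`-th roots of unity with indices in `N`. -/
noncomputable def rootVandermonde {m : ℕ} (N : Finset (Fin m)) : ℝ :=
  √(∏ x ∈ N, ∏ y ∈ N.erase x, |2 * Real.sin (Real.pi / m * ((x : ℝ) - y))|)

theorem sin_pi_div_mul_ne_zero {m : ℕ} {x y : Fin m} (h : x ≠ y) :
    Real.sin (Real.pi / m * ((x : ℝ) - y)) ≠ 0 := by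
  have hm : (0 : ℝ) < m := by exact_mod_cast x.pos
  intro h0
  obtain ⟨k, hk⟩ := Real.sin_eq_zero_iff.1 h0
  have h1 : (k : ℝ) * m = x - y := by
    field_simp at hk
    linarith
  have h2 : k * m = (x : ℤ) - y := by exact_mod_cast h1
  have hx := x.2
  have hy := y.2
  have h3 : k = 0 := by
    by_contra hk0
    rcases lt_or_gt_of_ne hk0 with h | h <;> nlinarith
  rw [h3, zero_mul] at h2
  exact h (Fin.ext (by omega))

theorem rootVandermonde_pos {m : ℕ} (N : Finset (Fin m)) : 0 < rootVandermonde N := by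
  refine Real.sqrt_pos.2 (Finset.prod_pos fun x _ => Finset.prod_pos fun y hy => ?_)
  rw [abs_pos]
  exact mul_ne_zero two_ne_zero (sin_pi_div_mul_ne_zero (Finset.ne_of_mem_erase hy).symm)

/-- A shift by `m` changes the angle by `π`, hence the sine only by a sign. Positions may therefore
be replaced by any integers congruent to them. -/
theorem abs_sin_pi_div_mul_eq {m : ℕ} {a b c d : ℤ} (h₁ : (m : ℤ) ∣ a - c) (h₂ : (m : ℤ) ∣ b - d) :
    |Real.sin (Real.pi / m * ((a : ℝ) - b))| = |Real.sin (Real.pi / m * ((c : ℝ) - d))| := by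
  obtain rfl | hm := eq_or_ne m 0
  · simp
  have hm' : (m : ℝ) ≠ 0 := Nat.cast_ne_zero.2 hm
  obtain ⟨k, hk⟩ := dvd_sub h₁ h₂
  have hk' : (a : ℝ) - b = (c - d) + m * k := by
    have : a - b = (c - d) + m * k := by linarith
    exact_mod_cast this
  rw [hk', show Real.pi / m * (((c : ℝ) - d) + m * k) = Real.pi / m * ((c : ℝ) - d) + k * Real.pi by
    field_simp, Real.sin_add_int_mul_pi, abs_mul, abs_zpow, abs_neg, abs_one, one_zpow, one_mul]

/-- Differences in `[0, m]` give angles in `[0, π]`, where the sine is nonnegative, so the signed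
product equals its modulus. -/
theorem sinProd_eq_rootVandermonde {m n : ℕ} (g : Fin n → ℤ) (τ : Fin n → Fin m)
    (hτ : ∀ b, (m : ℤ) ∣ g b - (τ b : ℕ)) (hinj : Function.Injective τ)
    (hg : ∀ i j, i < j → 0 ≤ g j - g i ∧ g j - g i ≤ m) :
    sinProd (fun b => Real.pi / m * g b) = rootVandermonde (Finset.univ.image τ) := by
  have hnn : ∀ i j, i < j → 0 ≤ 2 * Real.sin (Real.pi / m * g j - Real.pi / m * g i) := by
    intro i j hij
    have hm : (0 : ℝ) < m := by exact_mod_cast (τ i).pos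
    have h0 : (0 : ℝ) ≤ (g j : ℝ) - g i := by exact_mod_cast (hg i j hij).1
    have h1 : (g j : ℝ) - g i ≤ m := by exact_mod_cast (hg i j hij).2
    rw [← mul_sub]
    refine mul_nonneg zero_le_two (Real.sin_nonneg_of_nonneg_of_le_pi ?_ ?_)
    · have := Real.pi_pos
      positivity
    · rw [div_mul_eq_mul_div, div_le_iff₀ hm]
      exact mul_le_mul_of_nonneg_left h1 Real.pi_pos.le
  have h1 : 0 ≤ sinProd (fun b => Real.pi / m * g b) :=
    Finset.prod_nonneg fun i _ => Finset.prod_nonneg fun j hj => hnn i j (Finset.mem_Ioi.1 hj)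
  have h2 : ∀ i, ∏ y ∈ (Finset.univ.image τ).erase (τ i),
      |2 * Real.sin (Real.pi / m * ((τ i : ℝ) - y))| =
      ∏ j ∈ {i}ᶜ, |2 * Real.sin (Real.pi / m * g i - Real.pi / m * g j)| := by
    intro i
    rw [← Finset.image_erase hinj, Finset.prod_image hinj.injOn, Finset.compl_singleton]
    refine Finset.prod_congr rfl fun j _ => ?_
    rw [abs_mul, abs_mul, ← mul_sub, abs_sin_pi_div_mul_eq (hτ i) (hτ j)]
    simp
  -- The product over ordered pairs counts each pair twice, so it is the square of `sinProd`.
  rw [rootVandermonde, ← Real.sqrt_sq h1, Finset.prod_image hinj.injOn]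
  congr 1
  simp only [h2]
  rw [← Finset.prod_prod_Ioi_mul_eq_prod_prod_off_diag fun j i =>
    |2 * Real.sin (Real.pi / m * g i - Real.pi / m * g j)|, sinProd, sq, ← Finset.prod_mul_distrib]
  refine Finset.prod_congr rfl fun i _ => ?_
  rw [← Finset.prod_mul_distrib]
  refine Finset.prod_congr rfl fun j hj => ?_
  have h3 := hnn i j (Finset.mem_Ioi.1 hj)
  rw [← neg_sub (Real.pi / m * (g j : ℝ)), Real.sin_neg, mul_neg, abs_neg, abs_of_nonneg h3]

theorem sinProd_eq_zero {m n : ℕ} (g : Fin n → ℤ) (τ : Fin n → Fin m)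
    (hτ : ∀ b, (m : ℤ) ∣ g b - (τ b : ℕ)) (hinj : ¬ Function.Injective τ) :
    sinProd (fun b => Real.pi / m * g b) = 0 := by
  obtain ⟨i, j, hij, hne⟩ : ∃ i j, τ i = τ j ∧ i < j := by
    simp only [Function.Injective, not_forall] at hinj
    obtain ⟨i, j, hij, hne⟩ := hinj
    rcases lt_or_gt_of_ne hne with h | h
    exacts [⟨i, j, hij, h⟩, ⟨j, i, hij.symm, h⟩]
  refine Finset.prod_eq_zero (Finset.mem_univ i) (Finset.prod_eq_zero (Finset.mem_Ioi.2 hne) ?_)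
  have h := abs_sin_pi_div_mul_eq (hτ j) (hτ i)
  rw [hij, sub_self, mul_zero, Real.sin_zero, abs_zero, abs_eq_zero] at h
  rw [← mul_sub, h, mul_zero]

theorem dvd_val_finRotate_sub {m : ℕ} (l : Fin m) :
    (m : ℤ) ∣ ((finRotate m l : ℕ) : ℤ) - ((l : ℕ) + 1) := by
  rw [val_finRotate]
  split_ifs with h
  · exact ⟨-1, by push_cast; omega⟩
  · exact ⟨0, by push_cast; omega⟩

theorem rootVandermonde_finRotate {m : ℕ} (N : Finset (Fin m)) :
    rootVandermonde (N.map (finRotate m).toEmbedding) = rootVandermonde N := by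
  rw [rootVandermonde, rootVandermonde, Finset.prod_map]
  congr 1
  refine Finset.prod_congr rfl fun x _ => ?_
  rw [← Finset.map_erase, Finset.prod_map]
  refine Finset.prod_congr rfl fun y _ => ?_
  have h := abs_sin_pi_div_mul_eq (dvd_val_finRotate_sub x) (dvd_val_finRotate_sub y)
  rw [abs_mul, abs_mul]
  congr 1
  simpa using h

/-! ### Layer matchings as hops, and the eigenvector -/

/-- The positions of the particles `s` after those with index outside `E` have moved back by one
step on the cycle. -/
def hop {m n : ℕ} (s : Fin n → Fin m) (E : Finset (Fin n)) (b : Fin n) : Fin m :=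
  if b ∈ E then s b else (finRotate m).symm (s b)

/-- Matchings of the layer cycle are free fermion hops. -/
theorem card_layerMatching {m n : ℕ} {S T : Finset (Fin m)} (s : Fin n → Fin m)
    (hs : Function.Injective s) (hS : ∀ l, l ∉ S ↔ ∃ b, s b = l) :
    Nat.card (LayerMatching m S T) =
      Nat.card {E : Finset (Fin n) // Function.Injective (hop s E) ∧
        Finset.univ.image (hop s E) = Tᶜ} := by
  classical
  refine Nat.card_congr
    { toFun := fun X => ⟨Finset.univ.filter fun b => s b ∈ X.1.1, ?_⟩
      invFun := fun E => ⟨({l | ∃ b ∈ E.1, s b = l}, {l | ∃ b ∉ E.1, s b = finRotate m l}), ?_⟩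
      left_inv := fun X => ?_
      right_inv := fun E => ?_ }
  · obtain ⟨⟨D, U⟩, h1, h2⟩ := X
    unfold ExactlyOne at h1 h2
    simp only at h1 h2 ⊢
    have hU : ∀ b, s b ∉ D → (finRotate m).symm (s b) ∈ U := by
      intro b hb
      have := h1 (s b)
      have := (hS (s b)).2 ⟨b, rfl⟩
      tauto
    have hDU : ∀ l, l ∈ D → l ∉ U := by
      intro l
      have := h2 l
      tauto
    constructor
    · intro b c hbc
      simp only [hop, Finset.mem_filter, Finset.mem_univ, true_and] at hbc
      split_ifs at hbc with hb hc hc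
      · exact hs hbc
      · exact absurd (hbc ▸ hU c hc) (hDU _ hb)
      · exact absurd (hbc ▸ hU b hb) (hDU _ hc)
      · exact hs ((Equiv.injective _) hbc)
    · ext l
      simp only [Finset.mem_image, Finset.mem_univ, true_and, Finset.mem_compl, hop,
        Finset.mem_filter]
      constructor
      · rintro ⟨b, rfl⟩
        split_ifs with hb
        · have := h2 (s b)
          tauto
        · have := h2 ((finRotate m).symm (s b))
          have := hU b hb
          tauto
      · intro hl
        by_cases hD : l ∈ D
        · obtain ⟨b, rfl⟩ := (hS l).1 (by have := h1 l; tauto)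
          exact ⟨b, by simp [hD]⟩
        · have hlU : l ∈ U := by have := h2 l; tauto
          have h3 := h1 (finRotate m l)
          rw [Equiv.symm_apply_apply] at h3
          obtain ⟨b, hb⟩ := (hS (finRotate m l)).1 (by tauto)
          refine ⟨b, ?_⟩
          rw [hb, if_neg (by tauto), Equiv.symm_apply_apply]
  · obtain ⟨E, hE, hT⟩ := E
    simp only [Set.mem_ofPred_eq, Equiv.apply_symm_apply]
    refine ⟨fun l => ?_, fun l => ?_⟩
    · by_cases hl : l ∈ S
      · have : ¬ ∃ b, s b = l := fun h => (hS l).2 h hl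
        unfold ExactlyOne
        grind
      · obtain ⟨b, rfl⟩ := (hS l).1 hl
        unfold ExactlyOne
        have : ∀ c, s c = s b ↔ c = b := fun c => hs.eq_iff
        simp only [this, hl]
        simp [em]
    · have hT' : l ∈ T ↔ ¬ ∃ b, hop s E b = l := by
        rw [← not_iff_not, not_not, ← Finset.mem_compl, ← hT]
        simp
      have h1 : ∀ b, b ∈ E → hop s E b = s b := fun b hb => if_pos hb
      have h2 : ∀ b, b ∉ E → hop s E b = (finRotate m).symm (s b) := fun b hb => if_neg hb
      have h3 : ∀ b, s b = finRotate m l ↔ (finRotate m).symm (s b) = l := fun b => by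
        rw [Equiv.symm_apply_eq]
      rw [hT']
      simp only [h3]
      unfold ExactlyOne
      unfold Function.Injective at hE
      grind
  · apply Subtype.ext
    obtain ⟨⟨D, U⟩, h1, h2⟩ := X
    unfold ExactlyOne at h1
    simp only at h1
    refine Prod.ext (Set.ext fun l => ?_) (Set.ext fun l => ?_)
    · simp only [Set.mem_ofPred_eq, Finset.mem_filter, Finset.mem_univ, true_and]
      refine ⟨fun ⟨b, hb, h⟩ => h ▸ hb, fun h => ?_⟩
      obtain ⟨b, rfl⟩ := (hS l).1 (by have := h1 l; tauto)
      exact ⟨b, h, rfl⟩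
    · simp only [Set.mem_ofPred_eq, Finset.mem_filter, Finset.mem_univ, true_and]
      have h3 := h1 (finRotate m l)
      rw [Equiv.symm_apply_apply] at h3
      constructor
      · rintro ⟨b, hb, h⟩
        have := (hS (finRotate m l)).2 ⟨b, h⟩
        rw [h] at hb
        tauto
      · intro h
        obtain ⟨b, hb⟩ := (hS (finRotate m l)).1 (by tauto)
        exact ⟨b, by rw [hb]; tauto, hb⟩
  · apply Subtype.ext
    ext b
    simp [hs.eq_iff]

theorem transferMatrix_mulVec_rootVandermonde {m : ℕ} (hm : 3 ≤ m) (S : Finset (Fin m)) :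
    (transferMatrix m).mulVec (fun T => rootVandermonde Tᶜ) S =
      cosProd (m - S.card) (Real.pi / m) * rootVandermonde Sᶜ := by
  classical
  set n := m - S.card with hn
  have hcard : Sᶜ.card = n := by rw [Finset.card_compl, Fintype.card_fin]
  set s : Fin n ↪o Fin m := Sᶜ.orderEmbOfFin hcard with hsdef
  have hsS : ∀ l, l ∉ S ↔ ∃ b, s b = l := by
    intro l
    rw [← Finset.mem_compl, ← Finset.mem_coe, ← Finset.range_orderEmbOfFin _ hcard]
    rfl
  have himage : Finset.univ.image s = Sᶜ := by
    ext l
    simp [hsS]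
  have hmono : ∀ i j, i < j → (s i : ℕ) < s j := fun i j hij => s.strictMono hij
  -- Positions after the hop, not reduced modulo `m`: a particle leaving site 0 is recorded at `-1`,
  -- which keeps the particles in order.
  set g : Finset (Fin n) → Fin n → ℤ := fun E b => if b ∈ E then ((s b : ℕ) : ℤ) else (s b : ℕ) - 1
    with hg
  have hτ : ∀ E b, (m : ℤ) ∣ g E b - (hop s E b : ℕ) := by
    intro E b
    by_cases hb : b ∈ E
    · simp [hg, hop, hb]
    · have h := dvd_val_finRotate_sub ((finRotate m).symm (s b))
      rw [Equiv.apply_symm_apply] at h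
      simp only [hg, hop, hb, if_false]
      convert h using 1
      ring
  -- Before the hop the gaps lie in `[1, m - 1]`, and a hop changes a gap by at most one. The
  -- extreme values `0` and `m` are collisions.
  have hgap : ∀ E i j, i < j → 0 ≤ g E j - g E i ∧ g E j - g E i ≤ m := by
    intro E i j hij
    have h1 := hmono i j hij
    have h2 := (s j).2
    simp only [hg]
    split_ifs <;> omega
  have h0 : sinProd (fun b => Real.pi / m * ((s b : ℕ) : ℝ)) = rootVandermonde Sᶜ := by
    rw [← himage]
    have := sinProd_eq_rootVandermonde (fun b => ((s b : ℕ) : ℤ)) s (by simp) s.injective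
      (fun i j hij => by
        have h1 := hmono i j hij
        have h2 := (s j).2
        omega)
    simpa using this
  have hsum := sum_sinProd_piecewise (fun b => Real.pi / m * ((s b : ℕ) : ℝ)) (Real.pi / m)
  rw [h0] at hsum
  rw [← hsum]
  have hterm : ∀ E : Finset (Fin n), sinProd (E.piecewise (fun b => Real.pi / m * ((s b : ℕ) : ℝ))
      fun b => Real.pi / m * ((s b : ℕ) : ℝ) - Real.pi / m) =
      if Function.Injective (hop s E) then rootVandermonde (Finset.univ.image (hop s E))
      else 0 := by
    intro E
    have h1 : (E.piecewise (fun b => Real.pi / m * ((s b : ℕ) : ℝ))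
      fun b => Real.pi / m * ((s b : ℕ) : ℝ) - Real.pi / m) =
        fun b => Real.pi / m * (g E b : ℝ) := by
      ext b
      by_cases hb : b ∈ E
      · simp [hg, hb]
      · simp [hg, hb]
        ring
    rw [h1]
    split_ifs with hinj
    · exact sinProd_eq_rootVandermonde _ _ (hτ E) hinj (hgap E)
    · exact sinProd_eq_zero _ _ (hτ E) hinj
  simp only [hterm]
  have hA : ∀ T, transferMatrix m S T = ∑ E : Finset (Fin n), if Function.Injective (hop s E) ∧
      Finset.univ.image (hop s E) = Tᶜ then (1 : ℝ) else 0 := by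
    intro T
    rw [transferMatrix_apply hm, card_layerMatching s s.injective hsS, Nat.card_eq_fintype_card,
      Fintype.card_subtype, Finset.sum_boole]
  simp only [Matrix.mulVec, dotProduct, hA, Finset.sum_mul]
  rw [Finset.sum_comm]
  refine Finset.sum_congr rfl fun E _ => ?_
  split_ifs with hinj
  · rw [Finset.sum_eq_single (Finset.univ.image (hop s E))ᶜ]
    · simp [hinj]
    · intro T _ hT
      rw [if_neg, zero_mul]
      rintro ⟨-, h⟩
      exact hT (by rw [h, compl_compl])
    · simp
  · simp [hinj]

/-! ### Closed form of the eigenvalues -/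

/-- The old angles all survive; the two new ones are the outermost and are opposite, so their
cosines agree. -/
theorem cosProd_add_two (n : ℕ) (h : ℝ) :
    cosProd (n + 2) h = cosProd n h * (2 * Real.cos (h / 2 * (n + 1))) ^ 2 := by
  rw [cosProd, Finset.prod_range_succ, Finset.prod_range_succ', cosProd]
  push_cast
  have h1 : h / 2 * (2 * 0 - ((n : ℝ) + 2 - 1)) = -(h / 2 * (n + 1)) := by ring
  have h2 : h / 2 * (2 * ((n : ℝ) + 1) - (n + 2 - 1)) = h / 2 * (n + 1) := by ring
  have h3 : ∀ a : ℕ, h / 2 * (2 * ((a : ℝ) + 1) - (n + 2 - 1)) = h / 2 * (2 * a - (n - 1)) := by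
    intro a; ring
  simp only [h1, h2, h3, Real.cos_neg]
  ring

open Complex in
theorem norm_one_sub_exp_two_mul (θ : ℝ) : ‖1 - exp (2 * θ * I)‖ = |2 * Real.sin θ| := by
  have h := Complex.norm_exp_I_mul_ofReal_sub_one (2 * θ)
  rw [norm_sub_rev, ← Real.norm_eq_abs, ← mul_div_cancel_left₀ θ (two_ne_zero (α := ℝ)), ← h]
  congr 3
  push_cast
  ring

/-- The factors are the distances from 1 to the roots of `X^m + 1`, whose value at 1 is 2. -/
theorem cosProd_self {m : ℕ} (hm : m ≠ 0) : cosProd m (Real.pi / m) = 2 := by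
  have hm0 : (0 : ℝ) < m := by positivity
  have hmC : (m : ℂ) ≠ 0 := Nat.cast_ne_zero.2 hm
  have hζ := Complex.isPrimitiveRoot_exp m hm
  have hα : Complex.exp (Real.pi / m * Complex.I) ^ m = -1 := by
    rw [← Complex.exp_nat_mul, ← Complex.exp_pi_mul_I]
    congr 1
    field_simp
  have h := congrArg (Polynomial.eval 1) (X_pow_sub_C_eq_prod hζ (Nat.pos_of_ne_zero hm) hα)
  have h' := congrArg norm h
  simp only [Polynomial.eval_sub, Polynomial.eval_pow, Polynomial.eval_X, Polynomial.eval_C,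
    Polynomial.eval_prod, one_pow, norm_prod] at h'
  rw [show ‖(1 : ℂ) - -1‖ = 2 by norm_num] at h'
  rw [h', cosProd]
  refine Finset.prod_congr rfl fun a ha => ?_
  have ha' : (a : ℝ) + 1 ≤ m := by exact_mod_cast Finset.mem_range.1 ha
  have h1 : Complex.exp (2 * Real.pi * Complex.I / m) ^ a * Complex.exp (Real.pi / m * Complex.I) =
      Complex.exp (2 * ((Real.pi / m * (a + 1 / 2) : ℝ) : ℂ) * Complex.I) := by
    rw [← Complex.exp_nat_mul, ← Complex.exp_add]
    congr 1
    push_cast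
    ring
  rw [h1, norm_one_sub_exp_two_mul, abs_of_nonneg, ← Real.cos_sub_pi_div_two]
  · congr 2
    field_simp
    ring
  · refine mul_nonneg zero_le_two (Real.sin_nonneg_of_nonneg_of_le_pi ?_ ?_)
    · have := Real.pi_pos
      positivity
    · rw [div_mul_eq_mul_div, div_le_iff₀ hm0]
      exact mul_le_mul_of_nonneg_left (by linarith) Real.pi_pos.le

/-- The factors are the distances from 1 to the other `m`-th roots of unity, and these multiply to
`m`. -/
theorem cosProd_sub_one {m : ℕ} (hm : m ≠ 0) : cosProd (m - 1) (Real.pi / m) = m := by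
  obtain ⟨n, rfl⟩ := Nat.exists_eq_succ_of_ne_zero hm
  have hm0 : (0 : ℝ) < (n + 1 : ℕ) := by positivity
  have hζ := Complex.isPrimitiveRoot_exp (n + 1) hm
  have h' := congrArg norm hζ.prod_one_sub_pow_eq_order
  rw [norm_prod, show ((n : ℂ) + 1) = ((n + 1 : ℕ) : ℂ) by push_cast; rfl, Complex.norm_natCast]
    at h'
  rw [Nat.succ_eq_add_one, Nat.add_sub_cancel, cosProd]
  refine Eq.trans ?_ h'
  refine Finset.prod_congr rfl fun a ha => ?_
  have ha' : (a : ℝ) + 1 ≤ (n + 1 : ℕ) := by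
    exact_mod_cast Nat.succ_le_succ (Finset.mem_range.1 ha).le
  have h1 : Complex.exp (2 * Real.pi * Complex.I / (n + 1 : ℕ)) ^ (a + 1) =
      Complex.exp (2 * ((Real.pi / (n + 1 : ℕ) * (a + 1) : ℝ) : ℂ) * Complex.I) := by
    rw [← Complex.exp_nat_mul]
    congr 1
    push_cast
    ring
  rw [h1, norm_one_sub_exp_two_mul, abs_of_nonneg, ← Real.cos_sub_pi_div_two]
  · congr 2
    push_cast
    field_simp
    ring
  · refine mul_nonneg zero_le_two (Real.sin_nonneg_of_nonneg_of_le_pi ?_ ?_)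
    · have := Real.pi_pos
      positivity
    · rw [div_mul_eq_mul_div, div_le_iff₀ hm0]
      exact mul_le_mul_of_nonneg_left ha' Real.pi_pos.le

theorem lamMax_add_two (m p : ℕ) :
    lamMax m (p + 2) = lamMax m p / (4 * Real.sin (Real.pi * (p + 1) / (2 * m)) ^ 2) := by
  have hp : Even (p + 2) ↔ Even p := by simp [Nat.even_add]
  simp only [lamMax, hp, Nat.add_div_right p two_pos]
  split_ifs with h
  · obtain ⟨q, rfl⟩ := h
    rw [Finset.prod_range_succ, div_div]
    congr 5
    rw [show (q + q) / 2 = q by omega]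
    push_cast
    ring
  · obtain ⟨q, rfl⟩ := Nat.not_even_iff_odd.1 h
    rw [Finset.prod_Icc_succ_top (by omega), div_div]
    congr 5
    rw [show (2 * q + 1) / 2 = q by omega]
    push_cast
    rw [show Real.pi * (2 * (q : ℝ) + 1 + 1) = 2 * (Real.pi * (q + 1)) by ring,
      mul_div_mul_left _ _ two_ne_zero]

/-- Induction in steps of two from `p = 0` and `p = 1`: the sine removed on one side is the cosine
of the complementary angle on the other. -/
theorem lamMax_eq_cosProd {m : ℕ} (hm : m ≠ 0) : ∀ p ≤ m, lamMax m p = cosProd (m - p) (Real.pi / m)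
  | 0, _ => by rw [Nat.sub_zero, cosProd_self hm]; simp [lamMax]
  | 1, _ => by rw [cosProd_sub_one hm]; simp [lamMax]
  | p + 2, hp => by
    have hm0 : (0 : ℝ) < m := by positivity
    obtain ⟨n, rfl⟩ := Nat.exists_eq_add_of_le hp
    have h := lamMax_eq_cosProd hm p (by omega)
    rw [lamMax_add_two, h, Nat.add_sub_cancel_left, show p + 2 + n - p = n + 2 by omega,
      cosProd_add_two]
    have hcos : Real.cos (Real.pi / (p + 2 + n : ℕ) / 2 * (n + 1)) =
        Real.sin (Real.pi * (p + 1) / (2 * (p + 2 + n : ℕ))) := by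
      rw [← Real.cos_pi_div_two_sub]
      congr 1
      field_simp
      push_cast
      ring
    have hsin : 0 < Real.sin (Real.pi * (p + 1) / (2 * (p + 2 + n : ℕ))) := by
      refine Real.sin_pos_of_pos_of_lt_pi (by have := Real.pi_pos; positivity) ?_
      rw [div_lt_iff₀ (by positivity)]
      refine mul_lt_mul_of_pos_left ?_ Real.pi_pos
      push_cast
      linarith [(Nat.cast_nonneg p : (0 : ℝ) ≤ p), (Nat.cast_nonneg n : (0 : ℝ) ≤ n)]
    rw [hcos]
    generalize Real.sin (Real.pi * (p + 1) / (2 * (p + 2 + n : ℕ))) = y at hsin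
    field_simp
    ring

/-! ### Perron–Frobenius with an explicit positive eigenvector -/

/-- A positive eigenvector of a nonnegative matrix belongs to the largest eigenvalue. -/
theorem isLargestEigenvalue_of_pos {n : Type*} [Fintype n] [DecidableEq n] [Nonempty n]
    {M : Matrix n n ℝ} (hM : ∀ i j, 0 ≤ M i j) {v : n → ℝ} (hv : ∀ i, 0 < v i) {x : ℝ}
    (h : M.mulVec v = x • v) : IsLargestEigenvalue M x := by
  constructor
  · refine Module.End.hasEigenvalue_of_hasEigenvector (x := v)
      (Module.End.hasEigenvector_iff.2 ⟨Module.End.mem_eigenspace_iff.2 ?_, ?_⟩)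
    · rw [Matrix.toLin'_apply, h]
    · rintro rfl
      exact (hv (Classical.arbitrary n)).ne' rfl
  · intro μ hμ
    obtain ⟨u, hu, hu0⟩ := hμ.exists_hasEigenvector
    rw [Module.End.mem_eigenspace_iff, Matrix.toLin'_apply] at hu
    -- At an index maximizing `‖u i‖ / v i`, the triangle inequality in the eigenvalue equation
    -- gives `‖μ‖ ≤ x`.
    obtain ⟨i, hi⟩ := Finite.exists_max fun i => ‖u i‖ / v i
    set c := ‖u i‖ / v i with hc
    have hui : ‖u i‖ = c * v i := by rw [hc, div_mul_cancel₀ _ (hv i).ne']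
    have hle : ∀ j, ‖u j‖ ≤ c * v j := fun j => (div_le_iff₀ (hv j)).1 (hi j)
    have hcpos : 0 < c := by
      by_contra hneg
      refine hu0 (funext fun j => norm_le_zero_iff.1 ((hle j).trans ?_))
      exact mul_nonpos_of_nonpos_of_nonneg (not_lt.1 hneg) (hv j).le
    have h1 : ‖μ‖ * ‖u i‖ ≤ x * ‖u i‖ := by
      calc ‖μ‖ * ‖u i‖ = ‖∑ j, (M i j : ℂ) * u j‖ := by
            rw [← norm_mul]
            congr 1
            exact (congrFun hu i).symm
        _ ≤ ∑ j, M i j * (c * v j) := by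
            refine (norm_sum_le _ _).trans (Finset.sum_le_sum fun j _ => ?_)
            rw [norm_mul, Complex.norm_real, Real.norm_of_nonneg (hM i j)]
            exact mul_le_mul_of_nonneg_left (hle j) (hM i j)
        _ = c * (M.mulVec v) i := by
            rw [Matrix.mulVec, dotProduct, Finset.mul_sum]
            exact Finset.sum_congr rfl fun j _ => by ring
        _ = x * ‖u i‖ := by
            rw [h, hui, Pi.smul_apply, smul_eq_mul]
            ring
    exact le_of_mul_le_mul_right h1 (by rw [hui]; exact mul_pos hcpos (hv i))

/-- The positive eigenvector of the transfer matrix in all sectors. -/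
noncomputable def perronVector (m : ℕ) (S : Finset (Fin m)) : ℝ := rootVandermonde Sᶜ

theorem perronVector_pos {m : ℕ} (S : Finset (Fin m)) : 0 < perronVector m S :=
  rootVandermonde_pos _

theorem perronVector_rotateSet {m : ℕ} (S : Finset (Fin m)) :
    perronVector m (rotateSet S) = perronVector m S := by
  rw [perronVector, perronVector, ← rootVandermonde_finRotate Sᶜ]
  congr 1
  ext l
  simp [mem_rotateSet, Finset.mem_map_equiv]

theorem transferMatrix_mulVec_perronVector {m : ℕ} (hm : 3 ≤ m) (S : Finset (Fin m)) :
    (transferMatrix m).mulVec (perronVector m) S = lamMax m S.card * perronVector m S := by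
  rw [lamMax_eq_cosProd (by omega) _ (card_finset_fin_le S)]
  exact transferMatrix_mulVec_rootVandermonde hm S

theorem sectorBlock_apply (m p : ℕ) (S T : {S : Finset (Fin m) // S.card = p}) :
    sectorBlock m p S T = transferMatrix m S.1 T.1 := by
  rw [sectorBlock, Matrix.submatrix_apply]

theorem isLargestEigenvalue_sectorBlock {m : ℕ} (hm : 3 ≤ m) {p : ℕ} (hp : p ≤ m) :
    IsLargestEigenvalue (sectorBlock m p) (lamMax m p) := by
  have : Nonempty {S : Finset (Fin m) // S.card = p} := by
    obtain ⟨S, -, hS⟩ := Finset.exists_subset_card_eq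
      (s := (Finset.univ : Finset (Fin m))) (n := p) (by simpa using hp)
    exact ⟨⟨S, hS⟩⟩
  refine isLargestEigenvalue_of_pos (v := fun S => perronVector m S.1)
    (fun S T => ?_) (fun S => perronVector_pos S.1) ?_
  · rw [sectorBlock_apply]
    exact transferMatrix_nonneg m S.1 T.1
  ext S
  have h := transferMatrix_mulVec_perronVector hm S.1
  rw [S.2] at h
  rw [Pi.smul_apply, smul_eq_mul, ← h, Matrix.mulVec, Matrix.mulVec, dotProduct, dotProduct]
  simp only [sectorBlock_apply]
  calc ∑ T : {T : Finset (Fin m) // T.card = p}, transferMatrix m S.1 T.1 * perronVector m T.1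
      = ∑ T with T.card = p, transferMatrix m S.1 T * perronVector m T :=
        (Finset.sum_subtype _ (by simp) fun T => transferMatrix m S.1 T * perronVector m T).symm
    _ = ∑ T, transferMatrix m S.1 T * perronVector m T := by
        refine Finset.sum_filter_of_ne fun T _ hne => ?_
        by_contra hT
        exact hne (by rw [transferMatrix_eq_zero hm (fun h => hT (h.symm.trans S.2)), zero_mul])

/-! ### Upper bound for the growth of a sector -/

theorem Matrix.pow_nonneg_apply {n : Type*} [Fintype n] [DecidableEq n] {M : Matrix n n ℝ}
    (hM : ∀ i j, 0 ≤ M i j) (k : ℕ) : ∀ i j, 0 ≤ (M ^ k) i j := by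
  induction k with
  | zero =>
    intro i j
    rw [pow_zero, Matrix.one_apply]
    split_ifs <;> norm_num
  | succ k ih =>
    intro i j
    rw [pow_succ, Matrix.mul_apply]
    exact Finset.sum_nonneg fun l _ => mul_nonneg (ih i l) (hM l j)

theorem Matrix.mulVec_le_mulVec {n : Type*} [Fintype n] {M : Matrix n n ℝ}
    (hM : ∀ i j, 0 ≤ M i j) {v w : n → ℝ} (h : ∀ i, v i ≤ w i) (i : n) :
    M.mulVec v i ≤ M.mulVec w i :=
  Finset.sum_le_sum fun j _ => mul_le_mul_of_nonneg_left (h j) (hM i j)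

theorem transferMatrix_pow_mulVec_perronVector {m : ℕ} (hm : 3 ≤ m) (k : ℕ) (S : Finset (Fin m)) :
    (transferMatrix m ^ k).mulVec (perronVector m) S = lamMax m S.card ^ k * perronVector m S := by
  induction k generalizing S with
  | zero => simp
  | succ k ih =>
    rw [pow_succ', ← Matrix.mulVec_mulVec, pow_succ, mul_assoc,
      ← transferMatrix_mulVec_perronVector hm, Matrix.mulVec, Matrix.mulVec, dotProduct, dotProduct,
      Finset.mul_sum]
    refine Finset.sum_congr rfl fun T _ => ?_
    rw [ih]
    by_cases h : S.card = T.card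
    · rw [h]
      ring
    · rw [transferMatrix_eq_zero hm h]
      ring

/-- The diagonal entries are at least 1, so the matrix does not decrease the positive eigenvector.
-/
theorem one_le_lamMax {m : ℕ} (hm : 3 ≤ m) {p : ℕ} (hp : p ≤ m) : 1 ≤ lamMax m p := by
  obtain ⟨S, -, rfl⟩ := Finset.exists_subset_card_eq
    (s := (Finset.univ : Finset (Fin m))) (n := p) (by simpa using hp)
  refine le_of_mul_le_mul_right ?_ (perronVector_pos S)
  rw [← transferMatrix_mulVec_perronVector hm]
  refine (mul_le_mul_of_nonneg_right (one_le_transferMatrix_self hm S)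
    (perronVector_pos S).le).trans ?_
  exact Finset.single_le_sum (f := fun T => transferMatrix m S T * perronVector m T)
    (fun T _ => mul_nonneg (transferMatrix_nonneg m S T) (perronVector_pos T).le)
    (Finset.mem_univ S)

theorem exists_gonCount_le (m : ℕ) : ∃ C : ℝ, 0 < C ∧ ∀ S, gonCount m S ≤ C * perronVector m S := by
  obtain ⟨T, hT⟩ := Finite.exists_max fun S : Finset (Fin m) => gonCount m S / perronVector m S
  refine ⟨gonCount m T / perronVector m T + 1, ?_, fun S => ?_⟩
  · have := div_nonneg (gonCount_nonneg m T) (perronVector_pos T).le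
    linarith
  · rw [← div_le_iff₀ (perronVector_pos S)]
    linarith [hT S]

/-- The number of perfect matchings in a sector is at most of the order of the powers of the
largest eigenvalue. -/
theorem exists_card_le {m : ℕ} (hm : 3 ≤ m) {p : ℕ} (hp : p ≤ m) : ∃ C : ℝ, 0 < C ∧ ∀ k : ℕ,
    (Nat.card {M : PerfectMatching (barrelFullerene m k) // horizontalCount M 0 = p} : ℝ) ≤
      C * lamMax m p ^ k := by
  obtain ⟨C, hC, hle⟩ := exists_gonCount_le m
  have hlam := one_le_lamMax hm hp
  have hs : ∀ S, 0 ≤ sectorGon m p S := fun S => by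
    rw [sectorGon]
    split_ifs
    exacts [gonCount_nonneg m S, le_rfl]
  set c := ∑ S, sectorGon m p S * (C * perronVector m S) with hc
  have hc0 : 0 ≤ c := Finset.sum_nonneg fun S _ =>
    mul_nonneg (hs S) (mul_nonneg hC.le (perronVector_pos S).le)
  refine ⟨(c + 1) * lamMax m p, by positivity, fun k => ?_⟩
  rw [card_horizontalCount_eq hm, dotProduct]
  calc ∑ S, sectorGon m p S * ((transferMatrix m ^ (k + 1)).mulVec (gonCount m)) S
      ≤ ∑ S, sectorGon m p S * (C * perronVector m S) * lamMax m p ^ (k + 1) := by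
        refine Finset.sum_le_sum fun S _ => ?_
        by_cases hS : S.card = p
        · rw [mul_assoc]
          refine mul_le_mul_of_nonneg_left ?_ (hs S)
          refine (Matrix.mulVec_le_mulVec (Matrix.pow_nonneg_apply (transferMatrix_nonneg m) _)
            (w := C • perronVector m) (fun T => hle T) S).trans ?_
          rw [Matrix.mulVec_smul, Pi.smul_apply, transferMatrix_pow_mulVec_perronVector hm, hS,
            smul_eq_mul]
          exact le_of_eq (by ring)
        · simp [sectorGon, hS]
    _ = c * lamMax m p ^ (k + 1) := by rw [hc, Finset.sum_mul]
    _ ≤ (c + 1) * lamMax m p * lamMax m p ^ k := by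
        rw [pow_succ', ← mul_assoc]
        gcongr
        linarith

theorem card_eq_zero_of_not_even {m : ℕ} (hm : 3 ≤ m) {p : ℕ} (hp : ¬ Even (m - p)) (k : ℕ) :
    Nat.card {M : PerfectMatching (barrelFullerene m k) // horizontalCount M 0 = p} = 0 := by
  rw [← Nat.cast_eq_zero (R := ℝ), card_horizontalCount_eq hm]
  refine Finset.sum_eq_zero fun S _ => ?_
  rw [sectorGon]
  split_ifs with h
  · rw [gonCount_eq_zero (by rwa [h]), zero_mul]
  · rw [zero_mul]

/-! ### Lower bound for the growth of a sector -/

/-- On rotation invariant vectors the transfer matrix is symmetric. -/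
theorem vecMul_transferMatrix {m : ℕ} (hm : 3 ≤ m) {w : Finset (Fin m) → ℝ}
    (hw : ∀ S, w (rotateSet S) = w S) :
    Matrix.vecMul w (transferMatrix m) = (transferMatrix m).mulVec w := by
  ext T
  rw [Matrix.vecMul, Matrix.mulVec, dotProduct, dotProduct, ← rotateSet.sum_comp]
  refine Finset.sum_congr rfl fun S _ => ?_
  rw [hw, transferMatrix_rotateSet hm, mul_comm]

theorem pow_mulVec_rotateSet {m : ℕ} (hm : 3 ≤ m) {w : Finset (Fin m) → ℝ}
    (hw : ∀ S, w (rotateSet S) = w S) (k : ℕ) (S : Finset (Fin m)) :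
    ((transferMatrix m ^ k).mulVec w) (rotateSet S) = ((transferMatrix m ^ k).mulVec w) S := by
  induction k generalizing S with
  | zero => simpa using hw S
  | succ k ih =>
    rw [pow_succ', ← Matrix.mulVec_mulVec]
    set u := (transferMatrix m ^ k).mulVec w
    rw [Matrix.mulVec, Matrix.mulVec, dotProduct, dotProduct, ← rotateSet.sum_comp]
    refine Finset.sum_congr rfl fun T _ => ?_
    -- Two transpositions up to rotation compose to invariance under rotating both indices.
    rw [ih, transferMatrix_rotateSet hm, transferMatrix_rotateSet hm]

theorem vecMul_transferMatrix_pow {m : ℕ} (hm : 3 ≤ m) {w : Finset (Fin m) → ℝ}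
    (hw : ∀ S, w (rotateSet S) = w S) (k : ℕ) :
    Matrix.vecMul w (transferMatrix m ^ k) = (transferMatrix m ^ k).mulVec w := by
  induction k with
  | zero => simp
  | succ k ih =>
    rw [pow_succ, ← Matrix.vecMul_vecMul, ih,
      vecMul_transferMatrix hm (pow_mulVec_rotateSet hm hw k),
      Matrix.mulVec_mulVec, ← pow_succ', pow_succ]

theorem sectorGon_rotateSet {m p : ℕ} (S : Finset (Fin m)) :
    sectorGon m p (rotateSet S) = sectorGon m p S := by
  rw [sectorGon, sectorGon, card_rotateSet, gonCount_rotateSet]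

theorem sectorGon_nonneg (m p : ℕ) (S : Finset (Fin m)) : 0 ≤ sectorGon m p S := by
  rw [sectorGon]
  split_ifs
  exacts [gonCount_nonneg m S, le_rfl]

/-- The number of perfect matchings in a sector is at least of the order of the powers of the
largest eigenvalue. -/
theorem exists_le_card {m : ℕ} (hm : 3 ≤ m) {q : ℕ} (hq : 2 * q ≤ m) : ∃ c : ℝ, 0 < c ∧ ∀ k : ℕ,
    c * lamMax m (m - 2 * q) ^ k ≤
      (Nat.card {M : PerfectMatching (barrelFullerene m k) //
        horizontalCount M 0 = m - 2 * q} : ℝ) := by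
  set p := m - 2 * q with hp
  set A := transferMatrix m with hA
  set b := sectorGon m p with hb
  set v := perronVector m with hv
  set lam := lamMax m p with hlam
  have hlam1 : 1 ≤ lam := one_le_lamMax hm (Nat.sub_le _ _)
  have hA0 := Matrix.pow_nonneg_apply (transferMatrix_nonneg m)
  have hb0 : ∀ S, 0 ≤ b S := sectorGon_nonneg m p
  have hbg : ∀ S, b S ≤ gonCount m S := fun S => by
    rw [hb, sectorGon]
    split_ifs
    exacts [le_rfl, gonCount_nonneg m S]
  have hu0 : ∀ i S, 0 ≤ ((A ^ i).mulVec b) S := fun i S => by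
    rw [Matrix.mulVec, dotProduct]
    exact Finset.sum_nonneg fun T _ => mul_nonneg (hA0 i S T) (hb0 T)
  have hvb : 0 < v ⬝ᵥ b := by
    obtain ⟨S, hS, hpos⟩ := exists_gonCount_pos hq
    refine Finset.sum_pos' (fun T _ => mul_nonneg (perronVector_pos T).le (hb0 T))
      ⟨S, Finset.mem_univ S, mul_pos (perronVector_pos S) ?_⟩
    rwa [hb, sectorGon, if_pos hS]
  have hvv : 0 < v ⬝ᵥ v := by
    refine Finset.sum_pos (fun T _ => mul_pos (perronVector_pos T) (perronVector_pos T)) ?_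
    exact Finset.univ_nonempty
  -- By rotation invariance `v` is also a left eigenvector on each sector, and `b` is supported on
  -- sector `p`.
  have hvA : ∀ i, v ⬝ᵥ ((A ^ i).mulVec b) = lam ^ i * (v ⬝ᵥ b) := by
    intro i
    rw [Matrix.dotProduct_mulVec, vecMul_transferMatrix_pow hm perronVector_rotateSet, dotProduct,
      dotProduct, Finset.mul_sum]
    refine Finset.sum_congr rfl fun S _ => ?_
    rw [transferMatrix_pow_mulVec_perronVector hm]
    by_cases hS : S.card = p
    · rw [hS]
      ring
    · rw [hb, sectorGon, if_neg hS]
      ring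
  -- Cauchy–Schwarz against `v`. By symmetry the right side is `b ⬝ A^(2i) b`, so this settles even
  -- exponents.
  have hsq : ∀ i, lam ^ (2 * i) * ((v ⬝ᵥ b) ^ 2 / (v ⬝ᵥ v)) ≤
      ((A ^ i).mulVec b) ⬝ᵥ ((A ^ i).mulVec b) := by
    intro i
    have h := Finset.sum_mul_sq_le_sq_mul_sq Finset.univ v ((A ^ i).mulVec b)
    have h1 : (v ⬝ᵥ ((A ^ i).mulVec b)) ^ 2 ≤
        (v ⬝ᵥ v) * (((A ^ i).mulVec b) ⬝ᵥ ((A ^ i).mulVec b)) := by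
      simpa [dotProduct, sq] using h
    rw [hvA] at h1
    rw [mul_div_assoc', div_le_iff₀ hvv]
    refine le_of_eq_of_le ?_ (h1.trans_eq (mul_comm _ _))
    ring
  have hbA : ∀ i j, b ⬝ᵥ ((A ^ (i + j)).mulVec b) = ((A ^ i).mulVec b) ⬝ᵥ ((A ^ j).mulVec b) := by
    intro i j
    rw [pow_add, ← Matrix.mulVec_mulVec, Matrix.dotProduct_mulVec,
      vecMul_transferMatrix_pow hm sectorGon_rotateSet]
  -- For odd exponents: since the diagonal entries are at least 1, `A u ≥ u` entrywise for
  -- nonnegative `u`.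
  have hstep : ∀ i, ((A ^ i).mulVec b) ⬝ᵥ ((A ^ i).mulVec b) ≤
      ((A ^ i).mulVec b) ⬝ᵥ ((A ^ (i + 1)).mulVec b) := by
    intro i
    refine Finset.sum_le_sum fun S _ => mul_le_mul_of_nonneg_left ?_ (hu0 i S)
    rw [pow_succ', ← Matrix.mulVec_mulVec]
    set u := (A ^ i).mulVec b
    refine (le_mul_of_one_le_left (hu0 i S) (one_le_transferMatrix_self hm S)).trans ?_
    exact Finset.single_le_sum (f := fun T => A S T * u T)
      (fun T _ => mul_nonneg (transferMatrix_nonneg m S T) (hu0 i T)) (Finset.mem_univ S)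
  refine ⟨(v ⬝ᵥ b) ^ 2 / (v ⬝ᵥ v), by positivity, fun k => ?_⟩
  rw [card_horizontalCount_eq hm]
  have hge : b ⬝ᵥ ((A ^ (k + 1)).mulVec b) ≤ b ⬝ᵥ ((A ^ (k + 1)).mulVec (gonCount m)) :=
    Finset.sum_le_sum fun S _ => mul_le_mul_of_nonneg_left
      (Matrix.mulVec_le_mulVec (hA0 (k + 1)) hbg S) (hb0 S)
  refine le_trans ?_ hge
  have hpow : ∀ i, k ≤ 2 * i → (v ⬝ᵥ b) ^ 2 / (v ⬝ᵥ v) * lam ^ k ≤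
      ((A ^ i).mulVec b) ⬝ᵥ ((A ^ i).mulVec b) := fun i hi => by
    refine le_trans ?_ (hsq i)
    rw [mul_comm]
    exact mul_le_mul_of_nonneg_right (pow_le_pow_right₀ hlam1 hi) (by positivity)
  obtain ⟨i, hi | hi⟩ := Nat.even_or_odd' (k + 1)
  · rw [hi, two_mul, hbA]
    exact hpow i (by omega)
  · rw [hi, show 2 * i + 1 = i + (i + 1) by ring, hbA]
    exact (hpow i (by omega)).trans (hstep i)

/-! ### Comparison of the sectors -/

theorem cosProd_pos {m n : ℕ} (hn : n ≤ m) : 0 < cosProd n (Real.pi / m) := by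
  refine Finset.prod_pos fun a ha => mul_pos two_pos (Real.cos_pos_of_mem_Ioo ?_)
  have ha' : a + 1 ≤ n := Finset.mem_range.1 ha
  have h1 : (a : ℝ) + 1 ≤ n := by exact_mod_cast ha'
  have h2 : (n : ℝ) ≤ m := by exact_mod_cast hn
  have h3 : (0 : ℝ) ≤ a := Nat.cast_nonneg a
  have hm : (0 : ℝ) < m := by linarith
  have hpi := Real.pi_pos
  rw [show Real.pi / m / 2 * (2 * (a : ℝ) - (n - 1)) =
    Real.pi / 2 * ((2 * a - (n - 1)) / m) by ring]
  constructor
  · rw [neg_eq_neg_one_mul, mul_comm]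
    exact mul_lt_mul_of_pos_left (by rw [lt_div_iff₀ hm]; linarith) (by positivity)
  · exact mul_lt_of_lt_one_right (by positivity) (by rw [div_lt_one hm]; linarith)

/-- The new factor is `(2 cos θ)²` with `θ = π(2q+1)/(2m)`, and `θ < π/3` means `3(2q+1) < 2m`, that
is `q + 1 ≤ ⌊(m+1)/3⌋`. Equality is impossible, an odd number being compared with an even one, so
the opposite case is strict as well. -/
theorem cosProd_lt_cosProd_succ {m q : ℕ} (hq : q + 1 ≤ (m + 1) / 3) :
    cosProd (2 * q) (Real.pi / m) < cosProd (2 * (q + 1)) (Real.pi / m) := by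
  rw [show 2 * (q + 1) = 2 * q + 2 by ring, cosProd_add_two]
  refine lt_mul_of_one_lt_right (cosProd_pos (by omega)) (one_lt_pow₀ ?_ two_ne_zero)
  have h1 : 3 * (2 * (q : ℝ) + 1) < 2 * m := by exact_mod_cast (by omega : 3 * (2 * q + 1) < 2 * m)
  have hm : (0 : ℝ) < m := by linarith [(Nat.cast_nonneg q : (0 : ℝ) ≤ q)]
  have hpi := Real.pi_pos
  have h2 : Real.pi / m / 2 * (((2 * q : ℕ) : ℝ) + 1) < Real.pi / 3 := by
    push_cast
    rw [div_div, div_mul_eq_mul_div, div_lt_div_iff₀ (by positivity) (by norm_num)]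
    nlinarith
  have h3 := Real.cos_lt_cos_of_nonneg_of_le_pi_div_two (by positivity) (by linarith) h2
  rw [Real.cos_pi_div_three] at h3
  linarith

theorem cosProd_succ_lt_cosProd {m q : ℕ} (hq : (m + 1) / 3 ≤ q) (hqm : 2 * (q + 1) ≤ m) :
    cosProd (2 * (q + 1)) (Real.pi / m) < cosProd (2 * q) (Real.pi / m) := by
  rw [show 2 * (q + 1) = 2 * q + 2 by ring, cosProd_add_two]
  have h1 : 2 * (m : ℝ) < 3 * (2 * q + 1) := by exact_mod_cast (by omega : 2 * m < 3 * (2 * q + 1))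
  have h0 : 2 * (q : ℝ) + 1 ≤ m := by exact_mod_cast (by omega : 2 * q + 1 ≤ m)
  have hm : (0 : ℝ) < m := by linarith [(Nat.cast_nonneg q : (0 : ℝ) ≤ q)]
  have hpi := Real.pi_pos
  have h2 : Real.pi / 3 < Real.pi / m / 2 * (((2 * q : ℕ) : ℝ) + 1) := by
    push_cast
    rw [div_div, div_mul_eq_mul_div, div_lt_div_iff₀ (by norm_num) (by positivity)]
    nlinarith
  have h4 : Real.pi / m / 2 * (((2 * q : ℕ) : ℝ) + 1) ≤ Real.pi / 2 := by
    push_cast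
    rw [div_div, div_mul_eq_mul_div, div_le_div_iff₀ (by positivity) (by norm_num)]
    nlinarith
  have h3 := Real.cos_lt_cos_of_nonneg_of_le_pi_div_two (by positivity) h4 h2
  rw [Real.cos_pi_div_three] at h3
  have h5 : 0 ≤ Real.cos (Real.pi / m / 2 * (((2 * q : ℕ) : ℝ) + 1)) :=
    Real.cos_nonneg_of_neg_pi_div_two_le_of_le (by linarith) h4
  exact mul_lt_of_lt_one_right (cosProd_pos (by omega))
    (pow_lt_one₀ (by linarith) (by linarith) two_ne_zero)

theorem cosProd_lt_of_ne {m q : ℕ} (hqm : 2 * q ≤ m) (hne : q ≠ (m + 1) / 3) :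
    cosProd (2 * q) (Real.pi / m) < cosProd (2 * ((m + 1) / 3)) (Real.pi / m) := by
  rcases lt_or_gt_of_ne hne with h | h
  · have key : ∀ r, q + 1 ≤ r → r ≤ (m + 1) / 3 →
        cosProd (2 * q) (Real.pi / m) < cosProd (2 * r) (Real.pi / m) := by
      intro r hr
      induction r, hr using Nat.le_induction with
      | base => exact cosProd_lt_cosProd_succ
      | succ r hr ih => exact fun h => (ih (by omega)).trans (cosProd_lt_cosProd_succ h)
    exact key _ h le_rfl
  · have key : ∀ r, (m + 1) / 3 + 1 ≤ r → 2 * r ≤ m →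
        cosProd (2 * r) (Real.pi / m) < cosProd (2 * ((m + 1) / 3)) (Real.pi / m) := by
      intro r hr
      induction r, hr using Nat.le_induction with
      | base => exact cosProd_succ_lt_cosProd le_rfl
      | succ r hr ih =>
        exact fun h => (cosProd_succ_lt_cosProd (by omega) h).trans (ih (by omega))
    exact key _ h hqm

theorem lamMax_lt_lamMax_dominantSector {m : ℕ} (hm : 3 ≤ m) {p : ℕ} (hp : p ≤ m)
    (hev : Even (m - p)) (hne : p ≠ dominantSector m) :
    lamMax m p < lamMax m (dominantSector m) := by
  unfold dominantSector at *
  obtain ⟨q, hq⟩ := hev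
  rw [lamMax_eq_cosProd (by omega) _ hp, lamMax_eq_cosProd (by omega) _ (Nat.sub_le _ _), hq,
    Nat.sub_sub_self (by omega), ← two_mul]
  exact cosProd_lt_of_ne (by omega) (by omega)

/-! ### Rarity of the other sectors, and the growth constant -/

/-- The matchings outside the dominant sector are exponentially rare. -/
theorem exists_card_ne_dominantSector_le {m : ℕ} (hm : 3 ≤ m) :
    ∃ C r : ℝ, 0 < C ∧ 0 < r ∧ r < 1 ∧ ∀ k : ℕ,
      (Nat.card {M : PerfectMatching (barrelFullerene m k) //
          ∃ j : Fin (k + 2), horizontalCount M j ≠ dominantSector m} : ℝ)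
        ≤ C * (r ^ k * lamMax m (dominantSector m) ^ k) := by
  classical
  have hlam0 : 1 ≤ lamMax m (dominantSector m) := one_le_lamMax hm (Nat.sub_le _ _)
  set lam := lamMax m (dominantSector m) with hlam
  have key : ∀ s : Finset ℕ, (∀ p ∈ s, p ≤ m ∧ p ≠ dominantSector m) →
      ∃ C r : ℝ, 0 < C ∧ 0 < r ∧ r < 1 ∧ ∀ k : ℕ,
        ∑ p ∈ s, (Nat.card {M : PerfectMatching (barrelFullerene m k) //
          horizontalCount M 0 = p} : ℝ) ≤ C * (r ^ k * lam ^ k) := by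
    intro s
    induction s using Finset.induction_on with
    | empty => exact fun _ => ⟨1, 1 / 2, by norm_num, by norm_num, by norm_num, fun k => by
        rw [Finset.sum_empty]; positivity⟩
    | insert p s hps ih =>
      intro h
      obtain ⟨C, r, hC, hr, hr1, hle⟩ := ih fun p' hp' => h p' (Finset.mem_insert_of_mem hp')
      obtain ⟨hp, hpne⟩ := h p (Finset.mem_insert_self p s)
      simp only [Finset.sum_insert hps]
      by_cases hev : Even (m - p)
      · obtain ⟨C', hC', hle'⟩ := exists_card_le hm hp
        have hlp := one_le_lamMax hm hp
        have hlt := lamMax_lt_lamMax_dominantSector hm hp hev hpne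
        -- The rate is the largest ratio of eigenvalues met so far; it stays below 1 because there
        -- are finitely many sectors.
        refine ⟨C' + C, max (lamMax m p / lam) r, by positivity, lt_max_of_lt_right hr,
          max_lt ((div_lt_one (by positivity)).2 hlt) hr1, fun k => ?_⟩
        rw [add_mul]
        refine add_le_add ((hle' k).trans ?_) ((hle k).trans ?_)
        · refine mul_le_mul_of_nonneg_left ?_ hC'.le
          rw [← mul_pow]
          refine pow_le_pow_left₀ (by positivity) ?_ k
          rw [← div_le_iff₀ (by positivity)]
          exact le_max_left _ _
        · gcongr
          exact le_max_right _ _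
      · refine ⟨C, r, hC, hr, hr1, fun k => ?_⟩
        rw [card_eq_zero_of_not_even hm hev, Nat.cast_zero, zero_add]
        exact hle k
  obtain ⟨C, r, hC, hr, hr1, hle⟩ := key ((Finset.range (m + 1)).erase (dominantSector m))
    fun p hp => ⟨Nat.lt_succ_iff.1 (Finset.mem_range.1 (Finset.mem_of_mem_erase hp)),
      Finset.ne_of_mem_erase hp⟩
  refine ⟨C, r, hC, hr, hr1, fun k => le_trans ?_ (hle k)⟩
  rw [← Nat.cast_sum, Nat.cast_le, ← Finset.sum_coe_sort, ← Nat.card_sigma]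
  -- The count is the same in all slices, so a matching with one wrong slice is already wrong in
  -- slice 0 and is sorted by its count there.
  refine Nat.card_le_card_of_injective (fun M => ⟨⟨horizontalCount M.1 0, ?_⟩, ⟨M.1, rfl⟩⟩) ?_
  · obtain ⟨M, j, hj⟩ := M
    rw [horizontalCount_eq hm] at hj
    refine Finset.mem_erase.2 ⟨hj, Finset.mem_range.2 (Nat.lt_succ_of_le ?_)⟩
    rw [← card_horizontalSet]
    exact card_finset_fin_le _
  · intro M N h
    have h1 : (⟨horizontalCount M.1 0, ⟨M.1, rfl⟩⟩ :
        Σ p, {M : PerfectMatching (barrelFullerene m k) // horizontalCount M 0 = p}) =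
        ⟨horizontalCount N.1 0, ⟨N.1, rfl⟩⟩ :=
      congrArg (fun x : (Σ p : ((Finset.range (m + 1)).erase (dominantSector m)),
        {M : PerfectMatching (barrelFullerene m k) // horizontalCount M 0 = p.1}) =>
          (⟨x.1.1, x.2⟩ : Σ p, {M : PerfectMatching (barrelFullerene m k) //
            horizontalCount M 0 = p})) h
    exact Subtype.ext (congrArg (fun x : (Σ p, {M : PerfectMatching (barrelFullerene m k) //
      horizontalCount M 0 = p}) => x.2.1) h1)

theorem tendsto_rpow_one_div {c : ℝ} (hc : 0 < c) {x : ℝ} (hx : 0 ≤ x) :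
    Tendsto (fun k : ℕ => (c * x ^ k) ^ (1 / (k : ℝ))) atTop (𝓝 x) := by
  have h1 : Tendsto (fun k : ℕ => c ^ (1 / (k : ℝ)) * x) atTop (𝓝 (c ^ (0 : ℝ) * x)) :=
    ((tendsto_const_nhds.rpow tendsto_one_div_atTop_nhds_zero_nat (Or.inl hc.ne'))).mul_const x
  rw [Real.rpow_zero, one_mul] at h1
  refine h1.congr' ?_
  filter_upwards [eventually_ne_atTop 0] with k hk
  rw [Real.mul_rpow hc.le (pow_nonneg hx k), one_div, Real.pow_rpow_inv_natCast hx hk]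

/-- A perfect matching lies in the dominant sector or has a slice outside it. -/
theorem numPerfectMatchings_le {m : ℕ} (k : ℕ) :
    (numPerfectMatchings (barrelFullerene m k) : ℝ) ≤
      Nat.card {M : PerfectMatching (barrelFullerene m k) //
          horizontalCount M 0 = dominantSector m} +
      Nat.card {M : PerfectMatching (barrelFullerene m k) //
          ∃ j : Fin (k + 2), horizontalCount M j ≠ dominantSector m} := by
  classical
  rw [← Nat.cast_add, Nat.cast_le, numPerfectMatchings, ← Nat.card_sum]
  refine Nat.card_le_card_of_surjective (Sum.elim Subtype.val Subtype.val) fun M => ?_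
  by_cases h : horizontalCount M 0 = dominantSector m
  · exact ⟨Sum.inl ⟨M, h⟩, rfl⟩
  · exact ⟨Sum.inr ⟨M, 0, h⟩, rfl⟩

theorem mainTheorem2 (m : ℕ) (hm : 3 ≤ m) :
    -- the largest eigenvalue of the transfer matrix in each sector is given explicitly
    (∀ p : ℕ, p ≤ m → IsLargestEigenvalue (sectorBlock m p) (lamMax m p)) ∧
    -- the growth constant exists and equals the largest eigenvalue in the sector `p₀`
    Tendsto (fun k : ℕ =>
        (numPerfectMatchings (barrelFullerene m k) : ℝ) ^ (1 / (k : ℝ)))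
      atTop (𝓝 (lamMax m (dominantSector m))) ∧
    -- convergence in probability to `p₀` of the number of horizontal edges, uniformly on all slices
    (∀ ε : ℝ, 0 < ε →
      Tendsto (fun k : ℕ => matchingProb m k
          {M | ∃ j : Fin (k + 2), ε ≤ |(horizontalCount M j : ℝ) - (dominantSector m : ℝ)|})
        atTop (𝓝 0)) ∧
    -- the contribution of the other sectors is exponentially smaller
    (∃ C r : ℝ, 0 < C ∧ 0 < r ∧ r < 1 ∧ ∀ k : ℕ,
      (Nat.card {M : PerfectMatching (barrelFullerene m k) //
          ∃ j : Fin (k + 2), horizontalCount M j ≠ dominantSector m} : ℝ)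
        ≤ C * (r ^ k * lamMax m (dominantSector m) ^ k)) := by
  have hlam : 1 ≤ lamMax m (dominantSector m) := one_le_lamMax hm (Nat.sub_le _ _)
  obtain ⟨C, r, hC, hr, hr1, hbad⟩ := exists_card_ne_dominantSector_le hm
  obtain ⟨c, hc, hlow⟩ := exists_le_card hm (q := (m + 1) / 3) (by omega)
  obtain ⟨C', hC', hup⟩ := exists_card_le hm (p := dominantSector m) (Nat.sub_le _ _)
  have hge : ∀ k, c * lamMax m (dominantSector m) ^ k ≤
      (numPerfectMatchings (barrelFullerene m k) : ℝ) := fun k =>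
    (hlow k).trans (Nat.cast_le.2
      (Nat.card_le_card_of_injective Subtype.val Subtype.val_injective))
  have hle : ∀ k, (numPerfectMatchings (barrelFullerene m k) : ℝ) ≤
      (C' + C) * lamMax m (dominantSector m) ^ k := fun k => by
    refine (numPerfectMatchings_le k).trans ?_
    rw [add_mul]
    refine add_le_add (hup k) ((hbad k).trans ?_)
    refine mul_le_mul_of_nonneg_left ?_ hC.le
    exact mul_le_of_le_one_left (by positivity) (pow_le_one₀ hr.le hr1.le)
  refine ⟨fun p hp => isLargestEigenvalue_sectorBlock hm hp, ?_, fun ε hε => ?_,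
    C, r, hC, hr, hr1, hbad⟩
  -- The number of matchings lies between two constant multiples of the same power, and the
  -- constants disappear in the `k`-th root.
  · refine tendsto_of_tendsto_of_tendsto_of_le_of_le
      (tendsto_rpow_one_div hc (zero_le_one.trans hlam))
      (tendsto_rpow_one_div (add_pos hC' hC) (zero_le_one.trans hlam)) (fun k => ?_) (fun k => ?_)
    · exact Real.rpow_le_rpow (by positivity) (hge k) (by positivity)
    · exact Real.rpow_le_rpow (by positivity) (hle k) (by positivity)
  · have hlim : Tendsto (fun k : ℕ => C / c * r ^ k) atTop (𝓝 0) := by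
      simpa using (tendsto_pow_atTop_nhds_zero_of_lt_one hr.le hr1).const_mul (C / c)
    refine squeeze_zero (fun k => by unfold matchingProb; positivity) (fun k => ?_) hlim
    have hpos : 0 < c * lamMax m (dominantSector m) ^ k := by positivity
    rw [matchingProb, div_le_iff₀ (hpos.trans_le (hge k))]
    calc (Nat.card {M : PerfectMatching (barrelFullerene m k) | ∃ j : Fin (k + 2),
            ε ≤ |(horizontalCount M j : ℝ) - (dominantSector m : ℝ)|} : ℝ)
        ≤ Nat.card {M : PerfectMatching (barrelFullerene m k) //
          ∃ j : Fin (k + 2), horizontalCount M j ≠ dominantSector m} := by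
          rw [Nat.cast_le]
          refine Nat.card_le_card_of_injective (Subtype.map id fun M hM => ?_)
            (Subtype.map_injective _ Function.injective_id)
          obtain ⟨j, hj⟩ := hM
          refine ⟨j, fun h => ?_⟩
          simp only [id_eq] at h
          rw [h, sub_self, abs_zero] at hj
          exact absurd hε (not_lt.2 hj)
      _ ≤ C * (r ^ k * lamMax m (dominantSector m) ^ k) := hbad k
      _ = C / c * r ^ k * (c * lamMax m (dominantSector m) ^ k) := by
          field_simp
      _ ≤ C / c * r ^ k * numPerfectMatchings (barrelFullerene m k) :=
          mul_le_mul_of_nonneg_left (hge k) (by positivity)
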